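/- Let $(V,\sqsubseteq,\oplus,k)$ be a commutative integral quantale, i.e. a complete lattice with a commutative monoid structure such that $a\oplus\bigsqcup S=\bigsqcup_{x\in S}a\oplus x$ and $k=\top$, and suppose that $V$ is infinitely join distributive: $x\sqcap\bigsqcup_i x_i=\bigsqcup_i(x\sqcap x_i)$. A $V$-hemimetric on $X$ is a map $d\colon X\times X\to V$ with $k\sqsubseteq d(x,x)$ and $d(x,y)\oplus d(y,z)\sqsubseteq d(x,z)$. A category is enriched in $V$-hemimetric spaces if each hom-set carries a $V$-hemimetric and $d(f,f')\oplus d(g,g')\sqsubseteq d(g\circ f,g'\circ f')$; an isomorphism of such enriched categories is an isomorphism of the underlying categories which is an isometry on every hom-set. Let $\mathcal U=(\Sigma,E,E_q)$ be an unconditional $V$-quantitative algebraic theory: $\Sigma$ is a set of operations with finite arities, $E$ is a set of equations $s=t$ and $E_q$ is a set of quantitative equations $s=_\varepsilon t$ ($\varepsilon\in V$) between ordinary (cartesian) $\Sigma$-terms over a countable set of variables. Write $\mathcal U\vdash s=_\varepsilon t$ for the smallest relation that contains $E_q$ and satisfies: $s=_\bot t$; $s=_\varepsilon t$ and $\varepsilon'\sqsubseteq\varepsilon$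 give $s=_{\varepsilon'}t$; $s=_{\varepsilon_i}t$ for all $i\in I$ gives $s=_{\bigsqcup_i\varepsilon_i}t$; $s=_\top t$ if $s=t$ is provable from $E$ in equational logic; $s=_\varepsilon t$ and $t=_{\varepsilon'}r$ give $s=_{\varepsilon\oplus\varepsilon'}r$; closure under substitution; and $s_i=_{\varepsilon_i}t_i$ for all $i$ gives $o(s_1,\dots,s_n)=_{\sqcap_i\varepsilon_i}o(t_1,\dots,t_n)$ for every $n$-ary $o\in\Sigma$. The discrete enriched Lawvere theory $\mathrm{LT}(\mathcal U)$ has the natural numbers as objects; a morphism $n\to m$ is an $m$-tuple of cartesian terms in the variables $x_1,\dots,x_n$, modulo provable equality from $E$; composition is substitution; and $d(\langle f_i\rangle,\langle g_i\rangle)=\sqcap_i\bigsqcup\{\varepsilon\mid\mathcal U\vdash f_i=_\varepsilon g_i\}$. Let $\mathcal U'=(\Sigma',E',E'_q)$ be the following $V$-quantitative symmetric monoidal theory. The generators in $\Sigma'$ are the $n$-ary operations of $\Sigma$, as generators of type $n\to1$, together with $\mathrm{copy}\colon1\to2$ and $\mathrm{del}\colon1\to0$. Monoidal terms are built from generators,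 $\mathrm{id}\colon1\to1$, the empty diagram $0\to0$ and the symmetry $2\to2$ by sequential composition $;$ and parallel composition $\otimes$. A cartesian term $t$ in $n$ variables is represented by a monoidal term $\bar t\colon n\to1$: a variable $x_i$ by the $i$-th wire with all other wires deleted, and $o(t_1,\dots,t_p)$ by copying the $n$ wires $p$ times, then $\bar t_1\otimes\dots\otimes\bar t_p$, then $o$. The set $E'$ consists of $\bar s=\bar t$ for $(s=t)\in E$ (in every finite list of variables $x_1,\dots,x_n$ containing those of $s$ and $t$), the equations making $(\mathrm{copy},\mathrm{del})$ a cocommutative comonoid, and the naturality equations $o;\mathrm{copy}=\mathrm{copy}_n;(o\otimes o)$ and $o;\mathrm{del}=\mathrm{del}_n$ for every $n$-ary $o\in\Sigma$. The set $E'_q$ consists of $\bar s=_\varepsilon\bar t$ for $(s=_\varepsilon t)\in E_q$ (again in every such list of variables). The syntactic category $\mathrm{Syn}(\mathcal U')$ has the natural numbers as objects; a morphism $n\to m$ is a monoidal term of type $n\to m$ modulo the smallest congruence for $;$ and $\otimes$ containing $E'$ and the axioms of symmetric strict monoidal categories. Its distance is $d(f,g)=\bigsqcup\{\varepsilon\mid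 f=_\varepsilon g\in\overline{E'_q}\}$, where $\overline{E'_q}$ is the smallest set of quantitative equations between monoidal terms of equal type that contains $E'_q$ and is closed under: $f=_\top g$ if $f=g$ is provable from $E'$; $f=_\bot g$; $f=_\varepsilon g$, $g=_{\varepsilon'}h$ $\Rightarrow$ $f=_{\varepsilon\oplus\varepsilon'}h$; $f=_\varepsilon g$, $\varepsilon'\sqsubseteq\varepsilon$ $\Rightarrow$ $f=_{\varepsilon'}g$; $f=_{\varepsilon_i}g$ for all $i$ $\Rightarrow$ $f=_{\bigsqcup_i\varepsilon_i}g$; and $$(\mathrm{Seq}_\oplus)\ \ f_0=_\varepsilon f_1,\ g_0=_{\varepsilon'}g_1\ \Rightarrow\ f_0;g_0=_{\varepsilon\oplus\varepsilon'}f_1;g_1,\qquad(\mathrm{Par}_\sqcap)\ \ f_0=_\varepsilon f_1,\ g_0=_{\varepsilon'}g_1\ \Rightarrow\ f_0\otimes g_0=_{\varepsilon\sqcap\varepsilon'}f_1\otimes g_1.$$ Then $\mathrm{LT}(\mathcal U)$ and $\mathrm{Syn}(\mathcal U')$ are enriched in $V$-hemimetric spaces, and there is an isomorphism of enriched categories $\mathrm{LT}(\mathcal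 U)\cong\mathrm{Syn}(\mathcal U')$. -/

import Mathlib

open CategoryTheory

universe u v w

/-! ### Quantales -/

/-- A quantale `(V, ≤, +, 0)` is integral if its unit is the top element. -/
class IsIntegralQuantale (V : Type v) [AddCommMonoid V] [CompleteLattice V] : Prop where
  zero_eq_top : (0 : V) = ⊤

/-- Infinite join distributivity (IJD): binary meets distribute over arbitrary joins. -/
def IsIJD (V : Type v) [CompleteLattice V] : Prop :=
  ∀ (x : V) (A : Set V), x ⊓ sSup A = ⨆ a ∈ A, x ⊓ a

/-! ### Categories enriched in `V`-hemimetric spaces -/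

/-- A `V`-hemimetric on a type: `0 ≤ d x x` and `d x y + d y z ≤ d x z` in the order of `V`. -/
structure Hemimetric (V : Type v) [AddCommMonoid V] [CompleteLattice V] (X : Type w) where
  dist : X → X → V
  refl : ∀ x, 0 ≤ dist x x
  triangle : ∀ x y z, dist x y + dist y z ≤ dist x z

/-- An enrichment of a category in `V`-hemimetric spaces with the sum monoidal product:
every hom-set carries a `V`-hemimetric, and composition is nonexpansive. -/
class HemimetricEnriched (V : Type v) [AddCommMonoid V] [CompleteLattice V]
    (C : Type w) [Category.{u} C] where
  hemi : ∀ a b : C, Hemimetric V (a ⟶ b)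
  comp_nonexpansive : ∀ {a b c : C} (f f' : a ⟶ b) (g g' : b ⟶ c),
    (hemi a b).dist f f' + (hemi b c).dist g g' ≤ (hemi a c).dist (f ≫ g) (f' ≫ g')

/-- The distance between two parallel morphisms of an enriched category. -/
def homDist (V : Type v) [AddCommMonoid V] [CompleteLattice V]
    {C : Type w} [Category.{u} C] [HemimetricEnriched V C] {a b : C} (f g : a ⟶ b) : V :=
  (HemimetricEnriched.hemi (V := V) a b).dist f g

/-- An isomorphism of enriched categories: an isomorphism of the underlying categories which
is an isometry on every hom-set. -/
structure EnrichedIso (V : Type v) [AddCommMonoid V] [CompleteLattice V]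
    (C : Type*) [Category C] [HemimetricEnriched V C]
    (D : Type*) [Category D] [HemimetricEnriched V D] where
  functor : C ⥤ D
  inverse : D ⥤ C
  functor_inverse : functor ⋙ inverse = 𝟭 C
  inverse_functor : inverse ⋙ functor = 𝟭 D
  isometry : ∀ {a b : C} (f g : a ⟶ b),
    homDist V (functor.map f) (functor.map g) = homDist V f g

/-! ### Monoidal signatures and terms -/

/-- A monoidal signature: generators with an arity and a coarity. -/
structure MonSignature : Type (u + 1) where
  Gen : Type u
  ar : Gen → ℕ
  coar : Gen → ℕ

/-- Terms over a monoidal signature, indexed by arity and coarity. -/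
inductive MTerm (S : MonSignature.{u}) : ℕ → ℕ → Type u
  | gen (g : S.Gen) : MTerm S (S.ar g) (S.coar g)
  | id₁ : MTerm S 1 1
  | empty : MTerm S 0 0
  | swap : MTerm S 2 2
  | seq {n m l : ℕ} (s : MTerm S n m) (t : MTerm S m l) : MTerm S n l
  | par {n n' m m' : ℕ} (s : MTerm S n n') (t : MTerm S m m') : MTerm S (n + m) (n' + m')

namespace MTerm

variable {S : MonSignature.{u}}

/-- The same term, with its (co)arity rewritten along an equality of natural numbers. -/
def cast {n n' m m' : ℕ} (hn : n = n') (hm : m = m') (t : MTerm S n m) : MTerm S n' m' :=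
  hn ▸ hm ▸ t

/-- The identity on `n` wires. -/
def idN : (n : ℕ) → MTerm S n n
  | 0 => empty
  | n + 1 => par (idN n) id₁

/-- The symmetry moving one wire past `m` wires. -/
def symOne : (m : ℕ) → MTerm S (m + 1) (1 + m)
  | 0 => id₁
  | m + 1 => seq (cast rfl rfl (par (idN m) swap : MTerm S (m + 2) (m + 2)))
      (par (symOne m) id₁ : MTerm S (m + 1 + 1) (1 + m + 1))

/-- The symmetry `m + n → n + m`. -/
def symN (m : ℕ) : (n : ℕ) → MTerm S (m + n) (n + m)
  | 0 => cast (by omega) (by omega) (idN m)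
  | n + 1 => seq (par (symN m n) id₁ : MTerm S (m + n + 1) (n + m + 1))
      (cast (by omega) (by omega) (par (idN n) (symOne m)))

/-- The smallest congruence on terms containing the given equations `E` and the axioms of
symmetric strict monoidal categories. -/
inductive Eqv (E : ∀ n m : ℕ, Set (MTerm S n m × MTerm S n m)) :
    ∀ {n m : ℕ}, MTerm S n m → MTerm S n m → Prop
  | ax {n m : ℕ} {s t : MTerm S n m} : (s, t) ∈ E n m → Eqv E s t
  | refl {n m : ℕ} (s : MTerm S n m) : Eqv E s s
  | symm {n m : ℕ} {s t : MTerm S n m} : Eqv E s t → Eqv E t s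
  | trans {n m : ℕ} {s t r : MTerm S n m} : Eqv E s t → Eqv E t r → Eqv E s r
  | seq {n m l : ℕ} {s s' : MTerm S n m} {t t' : MTerm S m l} :
      Eqv E s s' → Eqv E t t' → Eqv E (s.seq t) (s'.seq t')
  | par {n n' m m' : ℕ} {s s' : MTerm S n n'} {t t' : MTerm S m m'} :
      Eqv E s s' → Eqv E t t' → Eqv E (s.par t) (s'.par t')
  | seq_assoc {n m l k : ℕ} (s : MTerm S n m) (t : MTerm S m l) (r : MTerm S l k) :
      Eqv E ((s.seq t).seq r) (s.seq (t.seq r))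
  | id_seq {n m : ℕ} (s : MTerm S n m) : Eqv E ((idN n).seq s) s
  | seq_id {n m : ℕ} (s : MTerm S n m) : Eqv E (s.seq (idN m)) s
  | par_assoc {n n' m m' l l' : ℕ} (s : MTerm S n n') (t : MTerm S m m') (r : MTerm S l l') :
      Eqv E (cast (Nat.add_assoc n m l) (Nat.add_assoc n' m' l') ((s.par t).par r))
        (s.par (t.par r))
  | empty_par {n m : ℕ} (s : MTerm S n m) :
      Eqv E (cast (Nat.zero_add n) (Nat.zero_add m) (empty.par s)) s
  | par_empty {n m : ℕ} (s : MTerm S n m) :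
      Eqv E (cast (Nat.add_zero n) (Nat.add_zero m) (s.par empty)) s
  | interchange {n m l n' m' l' : ℕ} (s : MTerm S n m) (t : MTerm S m l)
      (s' : MTerm S n' m') (t' : MTerm S m' l') :
      Eqv E ((s.seq t).par (s'.seq t')) ((s.par s').seq (t.par t'))
  | swap_swap : Eqv E (swap.seq swap) (idN 2)
  | sym_natural {n n' m m' : ℕ} (s : MTerm S n n') (t : MTerm S m m') :
      Eqv E ((s.par t).seq (symN n' m')) ((symN n m).seq (t.par s))

end MTerm

/-! ### Quantitative monoidal theories and their syntactic categories -/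

/-- A `V`-quantitative monoidal theory: equations and quantitative equations `s =_ε t` between
terms of the same type. -/
structure QMonTheory (V : Type v) : Type (max (u + 1) v) where
  sig : MonSignature.{u}
  eqs : ∀ n m : ℕ, Set (MTerm sig n m × MTerm sig n m)
  qeqs : ∀ n m : ℕ, Set (MTerm sig n m × MTerm sig n m × V)

namespace QMonTheory

variable {V : Type v}

/-- Provable equality of terms in the underlying monoidal theory. -/
abbrev Eqv (T : QMonTheory.{u} V) {n m : ℕ} (s t : MTerm T.sig n m) : Prop :=
  MTerm.Eqv T.eqs s t

variable [AddCommMonoid V] [CompleteLattice V]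

/-- The closure of the quantitative equations under the rules Refl, Triang, Bot, Mon, Join,
`Seq_⊕` and `Par_⊓`; `T.Closure s t ε` means that `s =_ε t` belongs to the closure. -/
inductive Closure (T : QMonTheory.{u} V) :
    ∀ {n m : ℕ}, MTerm T.sig n m → MTerm T.sig n m → V → Prop
  | ax {n m : ℕ} {s t : MTerm T.sig n m} {ε : V} : (s, t, ε) ∈ T.qeqs n m → Closure T s t ε
  | refl {n m : ℕ} {s t : MTerm T.sig n m} : T.Eqv s t → Closure T s t ⊤
  | triang {n m : ℕ} {s t r : MTerm T.sig n m} {ε ε' : V} :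
      Closure T s t ε → Closure T t r ε' → Closure T s r (ε + ε')
  | bot {n m : ℕ} (s t : MTerm T.sig n m) : Closure T s t ⊥
  | mon {n m : ℕ} {s t : MTerm T.sig n m} {ε ε' : V} :
      Closure T s t ε → ε' ≤ ε → Closure T s t ε'
  | join {n m : ℕ} {s t : MTerm T.sig n m} (A : Set V) :
      (∀ ε ∈ A, Closure T s t ε) → Closure T s t (sSup A)
  | seq_add {n m l : ℕ} {s s' : MTerm T.sig n m} {t t' : MTerm T.sig m l} {ε ε' : V} :
      Closure T s s' ε → Closure T t t' ε' → Closure T (s.seq t) (s'.seq t') (ε + ε')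
  | par_inf {n n' m m' : ℕ} {s s' : MTerm T.sig n n'} {t t' : MTerm T.sig m m'} {ε ε' : V} :
      Closure T s s' ε → Closure T t t' ε' → Closure T (s.par t) (s'.par t') (ε ⊓ ε')

/-- The syntactic distance between terms. -/
def termDist (T : QMonTheory.{u} V) {n m : ℕ} (s t : MTerm T.sig n m) : V :=
  sSup {ε | T.Closure s t ε}

theorem closure_termDist (T : QMonTheory.{u} V) {n m : ℕ} (s t : MTerm T.sig n m) :
    T.Closure s t (T.termDist s t) := .join _ fun _ h => h

theorem le_termDist (T : QMonTheory.{u} V) {n m : ℕ} {s t : MTerm T.sig n m} {ε : V}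
    (h : T.Closure s t ε) : ε ≤ T.termDist s t := le_sSup h

theorem termDist_mono [IsIntegralQuantale V] (T : QMonTheory.{u} V) {n m : ℕ}
    {s s' t t' : MTerm T.sig n m} (hs : T.Eqv s s') (ht : T.Eqv t t') :
    T.termDist s t ≤ T.termDist s' t' := by
  apply le_termDist
  have h := Closure.triang (Closure.triang (.refl hs.symm) (T.closure_termDist s t)) (.refl ht)
  rwa [← IsIntegralQuantale.zero_eq_top, zero_add, add_zero] at h

/-- Terms of a fixed type modulo provable equality. -/
def setoid (T : QMonTheory.{u} V) (n m : ℕ) : Setoid (MTerm T.sig n m) where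
  r := T.Eqv
  iseqv := ⟨.refl, .symm, .trans⟩

/-- The objects of the syntactic category: natural numbers. -/
def Syn (_T : QMonTheory.{u} V) : Type := ℕ

/-- The syntactic category: morphisms `n ⟶ m` are terms of arity `n` and coarity `m` modulo
provable equality. -/
instance synCategory (T : QMonTheory.{u} V) : Category.{u} T.Syn where
  Hom n m := Quotient (T.setoid n m)
  id n := Quotient.mk _ (MTerm.idN n)
  comp := Quotient.map₂ MTerm.seq fun _ _ h _ _ h' => MTerm.Eqv.seq h h'
  id_comp := by
    rintro n m ⟨s⟩
    exact Quotient.sound (MTerm.Eqv.id_seq s)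
  comp_id := by
    rintro n m ⟨s⟩
    exact Quotient.sound (MTerm.Eqv.seq_id s)
  assoc := by
    rintro n m l k ⟨s⟩ ⟨t⟩ ⟨r⟩
    exact Quotient.sound (MTerm.Eqv.seq_assoc s t r)

/-- The syntactic category, with the syntactic distance on its hom-sets. -/
instance synEnriched [IsIntegralQuantale V] (T : QMonTheory.{u} V) :
    HemimetricEnriched V T.Syn where
  hemi n m :=
    { dist := Quotient.lift₂ T.termDist fun _ _ _ _ h h' =>
        le_antisymm (T.termDist_mono h h') (T.termDist_mono h.symm h'.symm)
      refl := by
        rintro ⟨s⟩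
        exact le_top.trans (T.le_termDist (.refl (.refl s)))
      triangle := by
        rintro ⟨s⟩ ⟨t⟩ ⟨r⟩
        exact T.le_termDist (.triang (T.closure_termDist s t) (T.closure_termDist t r)) }
  comp_nonexpansive := by
    rintro n m l ⟨s⟩ ⟨s'⟩ ⟨t⟩ ⟨t'⟩
    exact T.le_termDist (.seq_add (T.closure_termDist s s') (T.closure_termDist t t'))

end QMonTheory

/-! ### Cartesian terms and unconditional quantitative algebraic theories -/

/-- An algebraic signature: operations with an arity. -/
structure AlgSignature : Type (u + 1) where
  Op : Type u
  ar : Op → ℕ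

/-- Cartesian terms with variables in `X`. -/
inductive CTerm (S : AlgSignature.{u}) (X : Type) : Type u
  | var (x : X) : CTerm S X
  | op (o : S.Op) (ts : Fin (S.ar o) → CTerm S X) : CTerm S X

namespace CTerm

variable {S : AlgSignature.{u}}

/-- Simultaneous substitution. -/
def subst {X Y : Type} (σ : X → CTerm S Y) : CTerm S X → CTerm S Y
  | var x => σ x
  | op o ts => op o fun i => (ts i).subst σ

/-- A term in the variables `x_0, …, x_{n-1}`, seen as a term in the variables `x_0, x_1, …`. -/
def incl {n : ℕ} (t : CTerm S (Fin n)) : CTerm S ℕ := t.subst fun i => var i.val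

theorem subst_subst {X Y Z : Type} (σ : X → CTerm S Y) (τ : Y → CTerm S Z) (t : CTerm S X) :
    (t.subst σ).subst τ = t.subst fun x => (σ x).subst τ := by
  induction t with
  | var x => rfl
  | op o ts ih => simp only [subst, ih]

theorem subst_var {X : Type} (t : CTerm S X) : t.subst var = t := by
  induction t with
  | var x => rfl
  | op o ts ih => simp only [subst, ih]

/-- A tuple of terms in finitely many variables, as a substitution on all variables. -/
def extend {m n : ℕ} (f : Fin m → CTerm S (Fin n)) (k : ℕ) : CTerm S ℕ :=
  if h : k < m then (f ⟨k, h⟩).incl else var k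

theorem incl_subst {m n : ℕ} (f : Fin m → CTerm S (Fin n)) (t : CTerm S (Fin m)) :
    (t.subst f).incl = t.incl.subst (extend f) := by
  simp only [incl, subst_subst, subst, extend, Fin.is_lt, dite_true]

/-- Equational logic: provable equality of cartesian terms from the equations `E`. -/
inductive Provable (E : Set (CTerm S ℕ × CTerm S ℕ)) : CTerm S ℕ → CTerm S ℕ → Prop
  | ax {s t : CTerm S ℕ} : (s, t) ∈ E → Provable E s t
  | refl (s : CTerm S ℕ) : Provable E s s
  | symm {s t : CTerm S ℕ} : Provable E s t → Provable E t s
  | trans {s t r : CTerm S ℕ} : Provable E s t → Provable E t r → Provable E s r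
  | subst {s t : CTerm S ℕ} (σ : ℕ → CTerm S ℕ) :
      Provable E s t → Provable E (s.subst σ) (t.subst σ)
  | congr (o : S.Op) {ss ts : Fin (S.ar o) → CTerm S ℕ} :
      (∀ i, Provable E (ss i) (ts i)) → Provable E (op o ss) (op o ts)

end CTerm

/-- An unconditional `V`-quantitative algebraic theory: equations and quantitative equations
(without premises) between cartesian terms over a countable set of variables. -/
structure QAlgTheory (V : Type v) : Type (max (u + 1) v) where
  sig : AlgSignature.{u}
  eqs : Set (CTerm sig ℕ × CTerm sig ℕ)
  qeqs : Set (CTerm sig ℕ × CTerm sig ℕ × V)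

namespace QAlgTheory

variable {V : Type v}

/-- Provable equality of terms from the equations of the theory. -/
abbrev Provable (U : QAlgTheory.{u} V) (s t : CTerm U.sig ℕ) : Prop := CTerm.Provable U.eqs s t

theorem Provable.subst_congr (U : QAlgTheory.{u} V) {σ τ : ℕ → CTerm U.sig ℕ}
    (h : ∀ k, U.Provable (σ k) (τ k)) (t : CTerm U.sig ℕ) :
    U.Provable (t.subst σ) (t.subst τ) := by
  induction t with
  | var x => exact h x
  | op o ts ih => exact .congr o ih

theorem Provable.extend (U : QAlgTheory.{u} V) {m n : ℕ} {f g : Fin m → CTerm U.sig (Fin n)}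
    (h : ∀ i, U.Provable (f i).incl (g i).incl) (k : ℕ) :
    U.Provable (CTerm.extend f k) (CTerm.extend g k) := by
  unfold CTerm.extend
  split
  · exact h _
  · exact .refl _

theorem Provable.comp (U : QAlgTheory.{u} V) {n m l : ℕ} {f f' : Fin m → CTerm U.sig (Fin n)}
    {g g' : Fin l → CTerm U.sig (Fin m)} (hf : ∀ i, U.Provable (f i).incl (f' i).incl)
    (hg : ∀ i, U.Provable (g i).incl (g' i).incl) (i : Fin l) :
    U.Provable ((g i).subst f).incl ((g' i).subst f').incl := by
  simp only [CTerm.incl_subst]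
  exact (CTerm.Provable.subst _ (hg i)).trans (Provable.subst_congr U (Provable.extend U hf) _)

/-- Tuples of terms in `n` variables modulo componentwise provable equality. -/
def setoid (U : QAlgTheory.{u} V) (n m : ℕ) : Setoid (Fin m → CTerm U.sig (Fin n)) where
  r f g := ∀ i, U.Provable (f i).incl (g i).incl
  iseqv := ⟨fun _ _ => .refl _, fun h i => (h i).symm, fun h h' i => (h i).trans (h' i)⟩

variable [AddCommMonoid V] [CompleteLattice V]

/-- Unconditional quantitative equational logic; `U.QProvable s t ε` means `U ⊢ s =_ε t`. -/
inductive QProvable (U : QAlgTheory.{u} V) : CTerm U.sig ℕ → CTerm U.sig ℕ → V → Prop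
  | ax {s t : CTerm U.sig ℕ} {ε : V} : (s, t, ε) ∈ U.qeqs → QProvable U s t ε
  | bot (s t : CTerm U.sig ℕ) : QProvable U s t ⊥
  | mon {s t : CTerm U.sig ℕ} {ε ε' : V} : QProvable U s t ε → ε' ≤ ε → QProvable U s t ε'
  | cont {s t : CTerm U.sig ℕ} (A : Set V) :
      (∀ ε ∈ A, QProvable U s t ε) → QProvable U s t (sSup A)
  | refl {s t : CTerm U.sig ℕ} : U.Provable s t → QProvable U s t ⊤
  | triang {s t r : CTerm U.sig ℕ} {ε ε' : V} :
      QProvable U s t ε → QProvable U t r ε' → QProvable U s r (ε + ε')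
  | subst {s t : CTerm U.sig ℕ} {ε : V} (σ : ℕ → CTerm U.sig ℕ) :
      QProvable U s t ε → QProvable U (s.subst σ) (t.subst σ) ε
  | nexp (o : U.sig.Op) {ss ts : Fin (U.sig.ar o) → CTerm U.sig ℕ}
      {ε : Fin (U.sig.ar o) → V} : (∀ i, QProvable U (ss i) (ts i) (ε i)) →
      QProvable U (.op o ss) (.op o ts) (⨅ i, ε i)

/-- The join of the derivable distances between two terms. -/
def termDist (U : QAlgTheory.{u} V) (s t : CTerm U.sig ℕ) : V := sSup {ε | U.QProvable s t ε}

/-- The distance between tuples of terms: the coordinatewise meet. -/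
def tupleDist (U : QAlgTheory.{u} V) {n m : ℕ} (f g : Fin m → CTerm U.sig (Fin n)) : V :=
  ⨅ i, U.termDist (f i).incl (g i).incl

theorem qprovable_termDist (U : QAlgTheory.{u} V) (s t : CTerm U.sig ℕ) :
    U.QProvable s t (U.termDist s t) := .cont _ fun _ h => h

theorem qprovable_tupleDist (U : QAlgTheory.{u} V) {n m : ℕ}
    (f g : Fin m → CTerm U.sig (Fin n)) (i : Fin m) :
    U.QProvable (f i).incl (g i).incl (U.tupleDist f g) :=
  .mon (U.qprovable_termDist _ _) (iInf_le _ i)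

theorem le_tupleDist (U : QAlgTheory.{u} V) {n m : ℕ} {f g : Fin m → CTerm U.sig (Fin n)}
    {ε : V} (h : ∀ i, U.QProvable (f i).incl (g i).incl ε) : ε ≤ U.tupleDist f g :=
  le_iInf fun i => le_sSup (h i)

theorem QProvable.subst_nonexpansive (U : QAlgTheory.{u} V) {σ τ : ℕ → CTerm U.sig ℕ} {ε : V}
    (h : ∀ k, U.QProvable (σ k) (τ k) ε) (t : CTerm U.sig ℕ) :
    U.QProvable (t.subst σ) (t.subst τ) ε := by
  induction t with
  | var x => exact h x
  | op o ts ih => exact .mon (.nexp o ih) (le_iInf fun _ => le_rfl)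

theorem QProvable.extend (U : QAlgTheory.{u} V) {m n : ℕ} {f g : Fin m → CTerm U.sig (Fin n)}
    {ε : V} (h : ∀ i, U.QProvable (f i).incl (g i).incl ε) (k : ℕ) :
    U.QProvable (CTerm.extend f k) (CTerm.extend g k) ε := by
  unfold CTerm.extend
  split
  · exact h _
  · exact .mon (.refl (.refl _)) le_top

theorem tupleDist_mono [IsIntegralQuantale V] (U : QAlgTheory.{u} V) {n m : ℕ}
    {f f' g g' : Fin m → CTerm U.sig (Fin n)} (hf : ∀ i, U.Provable (f i).incl (f' i).incl)
    (hg : ∀ i, U.Provable (g i).incl (g' i).incl) : U.tupleDist f g ≤ U.tupleDist f' g' := by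
  refine U.le_tupleDist fun i => ?_
  have h := QProvable.triang (.triang (.refl (hf i).symm) (U.qprovable_tupleDist f g i))
    (.refl (hg i))
  rwa [← IsIntegralQuantale.zero_eq_top, zero_add, add_zero] at h

theorem tupleDist_comp (U : QAlgTheory.{u} V) {n m l : ℕ} (f f' : Fin m → CTerm U.sig (Fin n))
    (g g' : Fin l → CTerm U.sig (Fin m)) :
    U.tupleDist f f' + U.tupleDist g g' ≤
      U.tupleDist (fun i => (g i).subst f) fun i => (g' i).subst f' := by
  refine U.le_tupleDist fun i => ?_
  simp only [CTerm.incl_subst]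
  exact .triang (.subst_nonexpansive U (.extend U (U.qprovable_tupleDist f f')) _)
    (.subst _ (U.qprovable_tupleDist g g' i))

/-- The objects of the discrete enriched Lawvere theory: natural numbers. -/
def LT (_U : QAlgTheory.{u} V) : Type := ℕ

/-- The Lawvere category: morphisms `n ⟶ m` are `m`-tuples of cartesian terms in `n` variables
modulo provable equality; composition is substitution. -/
instance ltCategory (U : QAlgTheory.{u} V) : Category.{u} U.LT where
  Hom n m := Quotient (U.setoid n m)
  id n := Quotient.mk (U.setoid n n) fun i : Fin n => CTerm.var i
  comp := Quotient.map₂ (fun f g i => (g i).subst f) fun _ _ hf _ _ hg =>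
    Provable.comp U hf hg
  id_comp := by
    rintro n m ⟨f⟩
    exact congrArg (Quotient.mk _) (funext fun i => CTerm.subst_var (f i))
  comp_id := by
    rintro n m ⟨f⟩
    rfl
  assoc := by
    rintro n m l k ⟨f⟩ ⟨g⟩ ⟨h⟩
    exact congrArg (Quotient.mk _) (funext fun i => (CTerm.subst_subst g f (h i)).symm)

/-- The discrete enriched Lawvere theory generated by `U`. -/
instance ltEnriched [IsAddQuantale V] [IsIntegralQuantale V] (U : QAlgTheory.{u} V) :
    HemimetricEnriched V U.LT where
  hemi n m :=
    { dist := Quotient.lift₂ U.tupleDist fun _ _ _ _ h h' =>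
        le_antisymm (U.tupleDist_mono h h')
          (U.tupleDist_mono (fun i => (h i).symm) fun i => (h' i).symm)
      refl := by
        rintro ⟨f⟩
        exact le_top.trans (U.le_tupleDist fun i => .refl (.refl _))
      triangle := by
        rintro ⟨f⟩ ⟨g⟩ ⟨h⟩
        exact U.le_tupleDist fun i =>
          .triang (U.qprovable_tupleDist f g i) (U.qprovable_tupleDist g h i) }
  comp_nonexpansive := by
    rintro n m l ⟨f⟩ ⟨f'⟩ ⟨g⟩ ⟨g'⟩
    exact U.tupleDist_comp f f' g g'

end QAlgTheory

/-! ### The monoidal counterpart of an algebraic theory -/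

/-- The generators of an algebraic signature together with copy and delete. -/
inductive ComonoidGen (S : AlgSignature.{u}) : Type u
  | op (o : S.Op) : ComonoidGen S
  | copy : ComonoidGen S
  | del : ComonoidGen S

/-- The monoidal signature with the operations of `S` as generators `n → 1`, together with
`copy : 1 → 2` and `del : 1 → 0`. -/
def AlgSignature.withComonoid (S : AlgSignature.{u}) : MonSignature.{u} where
  Gen := ComonoidGen S
  ar
    | .op o => S.ar o
    | .copy => 1
    | .del => 1
  coar
    | .op _ => 1
    | .copy => 2
    | .del => 0

namespace AlgSignature

variable {S : AlgSignature.{u}}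

/-- An operation as a generator. -/
def opT (o : S.Op) : MTerm S.withComonoid (S.ar o) 1 := MTerm.gen (S := S.withComonoid) (.op o)

/-- Copying one wire. -/
def copy : MTerm S.withComonoid 1 2 := MTerm.gen (S := S.withComonoid) .copy

/-- Deleting one wire. -/
def del : MTerm S.withComonoid 1 0 := MTerm.gen (S := S.withComonoid) .del

/-- Copying `n` wires. -/
def copyN : (n : ℕ) → MTerm S.withComonoid n (n + n)
  | 0 => .empty
  | n + 1 => .seq (.par (copyN n) copy)
      (.cast (by omega) (by omega) (((MTerm.idN n).par (MTerm.symN n 1)).par MTerm.id₁))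

/-- Deleting `n` wires. -/
def delN : (n : ℕ) → MTerm S.withComonoid n 0
  | 0 => .empty
  | n + 1 => .par (delN n) del

/-- The `i`-th of `n` wires, with all others deleted. -/
def proj (n : ℕ) (i : Fin n) : MTerm S.withComonoid n 1 :=
  .cast (by omega) (by omega) (((delN i.val).par MTerm.id₁).par (delN (n - 1 - i.val)))

/-- The pairing of `k` terms `n → 1`: the `n` inputs are copied and fed to each of them. -/
def tuple {n : ℕ} : (k : ℕ) → (Fin k → MTerm S.withComonoid n 1) → MTerm S.withComonoid n k
  | 0, _ => delN n
  | k + 1, f => .seq (copyN n) (.par (tuple k fun i => f i.castSucc) (f (Fin.last k)))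

/-- The monoidal term `n → 1` representing a cartesian term in `n` variables. -/
def toMonoidal {n : ℕ} : CTerm S (Fin n) → MTerm S.withComonoid n 1
  | .var i => proj n i
  | .op o ts => .seq (tuple (S.ar o) fun i => toMonoidal (ts i)) (opT o)

end AlgSignature

namespace QAlgTheory

variable {V : Type v}

open AlgSignature in
/-- The equations of the monoidal counterpart: the translated equations of `U` (in every finite
context of variables in which both sides are defined), the equations of a cocommutative
comonoid, and the naturality of copy and delete for every operation. -/
inductive MonEq (U : QAlgTheory.{u} V) :
    ∀ n m : ℕ, MTerm U.sig.withComonoid n m → MTerm U.sig.withComonoid n m → Prop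
  | ax {n : ℕ} (s t : CTerm U.sig (Fin n)) : (s.incl, t.incl) ∈ U.eqs →
      MonEq U n 1 (toMonoidal s) (toMonoidal t)
  | coassoc : MonEq U 1 3 (.seq copy (.par copy .id₁)) (.seq copy (.par .id₁ copy))
  | counit_left : MonEq U 1 1 (.seq copy (.par del .id₁)) .id₁
  | counit_right : MonEq U 1 1 (.seq copy (.par .id₁ del)) .id₁
  | cocomm : MonEq U 1 2 (.seq copy .swap) copy
  | copy_natural (o : U.sig.Op) : MonEq U (U.sig.ar o) 2 (.seq (opT o) copy)
      (.seq (copyN (U.sig.ar o)) (.par (opT o) (opT o)))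
  | del_natural (o : U.sig.Op) :
      MonEq U (U.sig.ar o) 0 (.seq (opT o) del) (delN (U.sig.ar o))

/-- The translated quantitative equations. -/
inductive MonQEq (U : QAlgTheory.{u} V) :
    ∀ n m : ℕ, MTerm U.sig.withComonoid n m → MTerm U.sig.withComonoid n m → V → Prop
  | ax {n : ℕ} (s t : CTerm U.sig (Fin n)) (ε : V) : (s.incl, t.incl, ε) ∈ U.qeqs →
      MonQEq U n 1 (AlgSignature.toMonoidal s) (AlgSignature.toMonoidal t) ε

/-- The quantitative monoidal theory obtained from `U` by adding a natural cocommutative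
comonoid. -/
def toMonoidal (U : QAlgTheory.{u} V) : QMonTheory.{u} V where
  sig := U.sig.withComonoid
  eqs n m := {p | U.MonEq n m p.1 p.2}
  qeqs n m := {p | U.MonQEq n m p.1 p.2.1 p.2.2}

end QAlgTheory

/-! This is Fox's theorem in quantitative form: a symmetric monoidal category in which every object
carries a natural cocommutative comonoid is cartesian. The naturality equations for generators
extend to all diagrams (`Diagram.isComonoidHom`). Hence a diagram `n → m` is determined by its `m`
projections (`Diagram.ext_proj`), and each projection represents a cartesian term
(`Diagram.mk_seq_proj`). Pairing cartesian terms (`tupleTerm`) and reading off components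
(`interpTerm`) are therefore inverse to each other up to provable equality.

Both translations must preserve derivations. From monoidal to cartesian, every diagram acts on
streams of cartesian terms (`eval`), and each monoidal rule becomes a derivation between
corresponding outputs (`provable_eval_of_eqv`, `qprovable_eval_of_closure`). From cartesian to
monoidal, substitution becomes precomposition with a tuple (`Provable.mk_toMonoidal_subst`,
`QProvable.monClosure_subst`).

The metric point is that sequential composition adds distances while an operation takes the meet of
the distances of its arguments. The two agree because in `tuple` and in `toMonoidal` the varying
terms sit in parallel, where `Par_⊓` gives a meet, while the copying diagrams and the operation stay
fixed and contribute only the unit `0`. Conversely, `Seq_⊕` is matched in the algebraic theory by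
congruence, substitution and one use of the triangle rule. -/

/-! ### Diagrams: terms of arbitrary type modulo provable equality -/

namespace MTerm

variable {S : MonSignature.{u}}

/-- Provable equality as a setoid. -/
def eqvSetoid (E : ∀ n m : ℕ, Set (MTerm S n m × MTerm S n m)) (n m : ℕ) :
    Setoid (MTerm S n m) where
  r := Eqv E
  iseqv := ⟨.refl, .symm, .trans⟩

end MTerm

/-- Diagrams of arbitrary arity and coarity: terms modulo provable equality. -/
structure Diagram {S : MonSignature.{u}} (E : ∀ n m : ℕ, Set (MTerm S n m × MTerm S n m)) :
    Type u where
  ofHom ::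
  dom : ℕ
  cod : ℕ
  hom : Quotient (MTerm.eqvSetoid E dom cod)

namespace Diagram

variable {S : MonSignature.{u}} {E : ∀ n m : ℕ, Set (MTerm S n m × MTerm S n m)}

/-- The diagram of a term. -/
def mk (E : ∀ n m : ℕ, Set (MTerm S n m × MTerm S n m)) {n m : ℕ} (s : MTerm S n m) :
    Diagram E := ⟨n, m, Quotient.mk _ s⟩

/-- Sequential composition of terms modulo provable equality. -/
def homSeq {n m l : ℕ} (a : Quotient (MTerm.eqvSetoid E n m))
    (b : Quotient (MTerm.eqvSetoid E m l)) : Quotient (MTerm.eqvSetoid E n l) :=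
  Quotient.map₂ MTerm.seq (fun _ _ h _ _ h' => MTerm.Eqv.seq h h') a b

/-- Sequential composition; the first diagram if the types do not match. -/
def seq (a b : Diagram E) : Diagram E :=
  if h : b.dom = a.cod then
    ⟨a.dom, b.cod, homSeq a.hom (h ▸ b.hom : Quotient (MTerm.eqvSetoid E a.cod b.cod))⟩
  else a

/-- Parallel composition. -/
def par (a b : Diagram E) : Diagram E :=
  ⟨a.dom + b.dom, a.cod + b.cod,
    Quotient.map₂ MTerm.par (fun _ _ h _ _ h' => MTerm.Eqv.par h h') a.hom b.hom⟩

scoped infixl:65 " ⨾ " => Diagram.seq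
scoped infixr:70 " ⊠ " => Diagram.par

/-- The passage between derivations and equality: rewriting with `=` on diagrams yields provable
equality of the underlying terms. -/
theorem mk_eq_mk {n m : ℕ} {s t : MTerm S n m} : mk E s = mk E t ↔ MTerm.Eqv E s t := by
  constructor
  · intro h
    simp only [mk, ofHom.injEq, heq_eq_eq, true_and] at h
    exact Quotient.exact h
  · intro h
    exact congrArg (ofHom n m) (Quotient.sound h)

theorem exists_mk (a : Diagram E) : ∃ (n m : ℕ) (s : MTerm S n m), mk E s = a := by
  obtain ⟨n, m, q⟩ := a
  induction q using Quotient.inductionOn with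
  | _ s => exact ⟨n, m, s, rfl⟩

-- This is the gain from bundling the arities into the diagram: casts disappear, so associativity
-- and unit laws of `⊠` become plain equations. The price is that laws for `⨾` need hypotheses
-- matching the types.
@[simp] theorem mk_cast {n n' m m' : ℕ} (hn : n = n') (hm : m = m') (s : MTerm S n m) :
    mk E (s.cast hn hm) = mk E s := by
  subst hn hm
  rfl

theorem mk_seq {n m l : ℕ} (s : MTerm S n m) (t : MTerm S m l) :
    mk E (s.seq t) = mk E s ⨾ mk E t := by
  rw [seq, dif_pos (show (mk E t).dom = (mk E s).cod from rfl)]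
  rfl

theorem mk_par {n m n' m' : ℕ} (s : MTerm S n n') (t : MTerm S m m') :
    mk E (s.par t) = mk E s ⊠ mk E t := rfl

@[simp] theorem dom_mk {n m : ℕ} (s : MTerm S n m) : (mk E s).dom = n := by rfl
@[simp] theorem cod_mk {n m : ℕ} (s : MTerm S n m) : (mk E s).cod = m := by rfl

@[simp] theorem dom_par (a b : Diagram E) : (a ⊠ b).dom = a.dom + b.dom := by rfl
@[simp] theorem cod_par (a b : Diagram E) : (a ⊠ b).cod = a.cod + b.cod := by rfl

@[simp] theorem dom_seq (a b : Diagram E) : (a ⨾ b).dom = a.dom := by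
  unfold seq
  split <;> rfl

@[simp] theorem cod_seq {a b : Diagram E} (h : a.cod = b.dom) : (a ⨾ b).cod = b.cod := by
  unfold seq
  rw [dif_pos h.symm]

/-- The identity diagram on `n` wires. -/
def id (n : ℕ) : Diagram E := mk E (MTerm.idN n)

/-- The symmetry of two wires. -/
def swap : Diagram E := mk E MTerm.swap

/-- The symmetry `m + n → n + m`. -/
def sym (m n : ℕ) : Diagram E := mk E (MTerm.symN m n)

@[simp] theorem dom_id (n : ℕ) : (id n : Diagram E).dom = n := by rfl
@[simp] theorem cod_id (n : ℕ) : (id n : Diagram E).cod = n := by rfl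
@[simp] theorem dom_swap : (swap : Diagram E).dom = 2 := by rfl
@[simp] theorem cod_swap : (swap : Diagram E).cod = 2 := by rfl
@[simp] theorem dom_sym (m n : ℕ) : (sym m n : Diagram E).dom = m + n := by rfl
@[simp] theorem cod_sym (m n : ℕ) : (sym m n : Diagram E).cod = n + m := by rfl

theorem seq_assoc {a b c : Diagram E} (h : a.cod = b.dom) (h' : b.cod = c.dom) :
    a ⨾ b ⨾ c = a ⨾ (b ⨾ c) := by
  obtain ⟨n, m, s, rfl⟩ := a.exists_mk
  obtain ⟨m', l, t, rfl⟩ := b.exists_mk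
  obtain ⟨l', k, r, rfl⟩ := c.exists_mk
  simp only [dom_mk, cod_mk] at h h'
  subst h h'
  simp only [← mk_seq]
  exact mk_eq_mk.2 (.seq_assoc s t r)

theorem id_seq {a : Diagram E} {n : ℕ} (h : n = a.dom) : id n ⨾ a = a := by
  obtain ⟨n, m, s, rfl⟩ := a.exists_mk
  simp only [dom_mk] at h
  subst h
  simp only [id, ← mk_seq]
  exact mk_eq_mk.2 (.id_seq s)

theorem seq_id {a : Diagram E} {n : ℕ} (h : a.cod = n) : a ⨾ id n = a := by
  obtain ⟨n, m, s, rfl⟩ := a.exists_mk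
  simp only [cod_mk] at h
  subst h
  simp only [id, ← mk_seq]
  exact mk_eq_mk.2 (.seq_id s)

theorem par_assoc (a b c : Diagram E) : (a ⊠ b) ⊠ c = a ⊠ b ⊠ c := by
  obtain ⟨n, m, s, rfl⟩ := a.exists_mk
  obtain ⟨m', l, t, rfl⟩ := b.exists_mk
  obtain ⟨l', k, r, rfl⟩ := c.exists_mk
  simp only [← mk_par]
  rw [← mk_eq_mk.2 (.par_assoc s t r), mk_cast]

theorem id_zero_eq : (id 0 : Diagram E) = mk E .empty := rfl

@[simp] theorem id_zero_par (a : Diagram E) : id 0 ⊠ a = a := by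
  obtain ⟨n, m, s, rfl⟩ := a.exists_mk
  rw [id_zero_eq, ← mk_par]
  conv_rhs => rw [← mk_eq_mk.2 (.empty_par s), mk_cast]

@[simp] theorem par_id_zero (a : Diagram E) : a ⊠ id 0 = a := by
  obtain ⟨n, m, s, rfl⟩ := a.exists_mk
  rw [id_zero_eq, ← mk_par]
  conv_rhs => rw [← mk_eq_mk.2 (.par_empty s), mk_cast]

theorem id_one_eq : (id 1 : Diagram E) = mk E .id₁ := id_zero_par (mk E .id₁)

theorem id_succ (n : ℕ) : (id (n + 1) : Diagram E) = id n ⊠ id 1 := by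
  rw [id_one_eq]
  rfl

theorem id_add (n m : ℕ) : (id (n + m) : Diagram E) = id n ⊠ id m := by
  induction m with
  | zero => simp
  | succ m ih => rw [← Nat.add_assoc, id_succ, ih, par_assoc, ← id_succ]

theorem par_seq_par {a b a' b' : Diagram E} (h : a.cod = b.dom) (h' : a'.cod = b'.dom) :
    (a ⊠ a') ⨾ (b ⊠ b') = (a ⨾ b) ⊠ (a' ⨾ b') := by
  obtain ⟨n, m, s, rfl⟩ := a.exists_mk
  obtain ⟨m₁, l, t, rfl⟩ := b.exists_mk
  obtain ⟨n', m', s', rfl⟩ := a'.exists_mk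
  obtain ⟨m₁', l', t', rfl⟩ := b'.exists_mk
  simp only [dom_mk, cod_mk] at h h'
  subst h h'
  simp only [← mk_seq, ← mk_par]
  exact (mk_eq_mk.2 (.interchange s t s' t')).symm

theorem seq_par_id {a b : Diagram E} (h : a.cod = b.dom) (n : ℕ) :
    (a ⨾ b) ⊠ id n = (a ⊠ id n) ⨾ (b ⊠ id n) := by
  rw [par_seq_par h rfl, seq_id (a := id n) (cod_id n)]

theorem id_par_seq {a b : Diagram E} (h : a.cod = b.dom) (n : ℕ) :
    id n ⊠ (a ⨾ b) = (id n ⊠ a) ⨾ (id n ⊠ b) := by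
  rw [par_seq_par rfl h, seq_id (a := id n) (cod_id n)]

theorem swap_swap : (swap ⨾ swap : Diagram E) = id 2 := by
  simp only [swap, ← mk_seq]
  exact mk_eq_mk.2 .swap_swap

theorem par_seq_sym {a b : Diagram E} {n m : ℕ} (h : a.cod = n) (h' : b.cod = m) :
    (a ⊠ b) ⨾ sym n m = sym a.dom b.dom ⨾ (b ⊠ a) := by
  obtain ⟨n, n', s, rfl⟩ := a.exists_mk
  obtain ⟨m, m', t, rfl⟩ := b.exists_mk
  simp only [cod_mk] at h h'
  subst h h'
  rw [dom_mk, dom_mk, sym, sym, ← mk_par, ← mk_par, ← mk_seq, ← mk_seq]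
  exact mk_eq_mk.2 (.sym_natural s t)

@[simp] theorem sym_zero (m : ℕ) : (sym m 0 : Diagram E) = id m := by
  simp [sym, MTerm.symN, id]

theorem mk_symOne (m : ℕ) : mk E (MTerm.symOne m) = sym m 1 := by
  rw [sym, MTerm.symN, mk_seq, mk_cast, mk_par, mk_par, ← id_one_eq]
  change _ = sym m 0 ⊠ id 1 ⨾ id 0 ⊠ mk E (MTerm.symOne m)
  rw [sym_zero, id_zero_par, ← id_succ, id_seq]
  rfl

theorem sym_succ (m n : ℕ) :
    (sym m (n + 1) : Diagram E) = (sym m n ⊠ id 1) ⨾ (id n ⊠ sym m 1) := by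
  rw [← mk_symOne, id_one_eq, sym, MTerm.symN, mk_seq, mk_cast, mk_par, mk_par]
  rfl

theorem sym_succ_one (m : ℕ) :
    (sym (m + 1) 1 : Diagram E) = (id m ⊠ swap) ⨾ (sym m 1 ⊠ id 1) := by
  rw [← mk_symOne, ← mk_symOne, id_one_eq, MTerm.symOne, mk_seq, mk_cast, mk_par, mk_par]
  rfl

@[simp] theorem zero_sym_one : (sym 0 1 : Diagram E) = id 1 := by
  rw [← mk_symOne, id_one_eq]
  rfl

theorem sym_one_one : (sym 1 1 : Diagram E) = swap := by
  rw [sym_succ_one, zero_sym_one, id_zero_par, ← id_succ, seq_id]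
  rfl

/-- The hexagon law for moving a single wire past two blocks. Only the recursion on single wires is
built into `symOne`, so the law for blocks needs induction on `m`. -/
theorem sym_add_one (n m : ℕ) :
    (sym (n + m) 1 : Diagram E) = (id n ⊠ sym m 1) ⨾ (sym n 1 ⊠ id m) := by
  induction m with
  | zero => rw [Nat.add_zero, zero_sym_one, par_id_zero, ← id_succ, id_seq]; simp
  | succ m ih =>
    rw [← Nat.add_assoc, sym_succ_one, ih, sym_succ_one, id_succ m, id_add, par_assoc]
    rw [seq_par_id, id_par_seq, seq_assoc, par_assoc, par_assoc]
    all_goals simp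
    all_goals omega

end Diagram

/-! ### Evaluation of monoidal terms on streams of cartesian terms -/

namespace CTerm

variable {S : AlgSignature.{u}}

/-- This lets identities between terms in `n` variables be checked after evaluation on streams,
where no arithmetic of finite index types occurs. -/
theorem incl_injective {n : ℕ} : Function.Injective (incl : CTerm S (Fin n) → CTerm S ℕ) := by
  intro s
  induction s with
  | var x =>
    intro t h
    cases t with
    | var y =>
      simp only [incl, subst, var.injEq] at h
      rw [Fin.ext h]
    | op o ts => simp [incl, subst] at h
  | op o ss ih =>
    intro t h
    cases t with
    | var y => simp [incl, subst] at h
    | op o' ts =>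
      simp only [incl, subst, op.injEq] at h
      obtain ⟨rfl, h⟩ := h
      rw [heq_eq_eq] at h
      exact congrArg (op o) (funext fun i => ih i (congrFun h i))

theorem subst_incl {n : ℕ} {X : Type} (t : CTerm S (Fin n)) (v : ℕ → CTerm S X) :
    t.incl.subst v = t.subst fun i : Fin n => v i := by
  simp only [incl, subst_subst, subst]

end CTerm

namespace AlgSignature

variable {S : AlgSignature.{u}}

/-- The action of a monoidal term `n → m` on streams of cartesian terms: the first `m` values
depend on the first `n` arguments, the others are irrelevant. -/
def eval : {n m : ℕ} → MTerm S.withComonoid n m → (ℕ → CTerm S ℕ) → ℕ → CTerm S ℕ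
  | _, _, .gen (ComonoidGen.op o), v, _ => .op o fun i => v i
  | _, _, .gen ComonoidGen.copy, v, _ => v 0
  | _, _, .gen ComonoidGen.del, v, _ => v 0
  | _, _, .id₁, v, i => v i
  | _, _, .empty, v, i => v i
  | _, _, .swap, v, i => if i = 0 then v 1 else v 0
  | _, _, .seq s t, v, i => eval t (eval s v) i
  | _, _, .par (n := n) (n' := n') s t, v, i =>
      if i < n' then eval s v i else eval t (fun j => v (n + j)) (i - n')

@[simp] theorem eval_opT (o : S.Op) (v : ℕ → CTerm S ℕ) (i : ℕ) :
    eval (opT o) v i = .op o fun i => v i := rfl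
@[simp] theorem eval_copy (v : ℕ → CTerm S ℕ) (i : ℕ) : eval copy v i = v 0 := rfl
@[simp] theorem eval_id₁ (v : ℕ → CTerm S ℕ) (i : ℕ) : eval .id₁ v i = v i := rfl
@[simp] theorem eval_swap (v : ℕ → CTerm S ℕ) (i : ℕ) :
    eval .swap v i = if i = 0 then v 1 else v 0 := rfl
@[simp] theorem eval_seq {n m l : ℕ} (s : MTerm S.withComonoid n m)
    (t : MTerm S.withComonoid m l) (v : ℕ → CTerm S ℕ) (i : ℕ) :
    eval (s.seq t) v i = eval t (eval s v) i := rfl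
@[simp] theorem eval_par {n n' m m' : ℕ} (s : MTerm S.withComonoid n n')
    (t : MTerm S.withComonoid m m') (v : ℕ → CTerm S ℕ) (i : ℕ) :
    eval (s.par t) v i = if i < n' then eval s v i else eval t (fun j => v (n + j)) (i - n') :=
  rfl

@[simp] theorem eval_cast {n n' m m' : ℕ} (hn : n = n') (hm : m = m')
    (s : MTerm S.withComonoid n m) : eval (s.cast hn hm) = eval s := by
  subst hn hm
  rfl

/-- Evaluation preserves every relation that is compatible with the operations. -/
theorem eval_rel {R : CTerm S ℕ → CTerm S ℕ → Prop}
    (hR : ∀ (o : S.Op) (ss ts : Fin (S.ar o) → CTerm S ℕ),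
      (∀ i, R (ss i) (ts i)) → R (.op o ss) (.op o ts))
    {n m : ℕ} (s : MTerm S.withComonoid n m) {v w : ℕ → CTerm S ℕ}
    (h : ∀ i < n, R (v i) (w i)) {i : ℕ} (hi : i < m) : R (eval s v i) (eval s w i) := by
  induction s generalizing v w i with
  | gen g =>
    cases g with
    | op o => exact hR o _ _ fun i => h i i.2
    | copy => exact h 0 Nat.one_pos
    | del => exact absurd hi (Nat.not_lt_zero i)
  | id₁ => exact h i hi
  | empty => exact h i hi
  | swap =>
    rw [eval_swap, eval_swap]
    split
    · exact h 1 (by omega)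
    · exact h 0 (by omega)
  | seq s t ihs iht => exact iht (fun i hi => ihs h hi) hi
  | par s t ihs iht =>
    rw [eval_par, eval_par]
    split
    · exact ihs (fun i hi => h i (by omega)) ‹_›
    · exact iht (fun i hi => h _ (by omega)) (by omega)

/-- Outputs beyond the coarity are junk, so two streams may be compared only on the meaningful
indices; this is `eval_rel` for the relation of equality. -/
theorem eval_congr {n m : ℕ} (s : MTerm S.withComonoid n m) {v w : ℕ → CTerm S ℕ}
    (h : ∀ i < n, v i = w i) {i : ℕ} (hi : i < m) : eval s v i = eval s w i :=
  eval_rel (R := Eq) (fun _ _ _ h => congrArg _ (funext h)) s h hi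

theorem eval_subst {n m : ℕ} (s : MTerm S.withComonoid n m) (σ v : ℕ → CTerm S ℕ) (i : ℕ) :
    (eval s v i).subst σ = eval s (fun j => (v j).subst σ) i := by
  induction s generalizing v i with
  | gen g => cases g <;> rfl
  | id₁ => rfl
  | empty => rfl
  | swap =>
    rw [eval_swap, eval_swap]
    split <;> rfl
  | seq s t ihs iht =>
    rw [eval_seq, eval_seq, iht]
    exact congrFun (congrArg _ (funext (ihs v))) i
  | par s t ihs iht =>
    rw [eval_par, eval_par]
    split
    · exact ihs v i
    · exact iht _ _

theorem eval_idN {n : ℕ} (v : ℕ → CTerm S ℕ) {i : ℕ} (hi : i < n) :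
    eval (.idN n) v i = v i := by
  induction n generalizing i with
  | zero => omega
  | succ n ih =>
    rw [MTerm.idN, eval_par]
    split
    · exact ih ‹_›
    · rw [eval_id₁, Nat.add_sub_cancel' (by omega)]

theorem eval_symOne {m : ℕ} (v : ℕ → CTerm S ℕ) {i : ℕ} (hi : i < 1 + m) :
    eval (.symOne m) v i = if i = 0 then v m else v (i - 1) := by
  induction m generalizing v i with
  | zero =>
    obtain rfl : i = 0 := by omega
    rfl
  | succ m ih =>
    rw [MTerm.symOne, eval_seq, eval_par]
    split
    · rw [ih _ ‹_›]
      split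
      · simp
      · rw [eval_cast, eval_par, if_pos (by omega), eval_idN _ (by omega)]
    · obtain rfl : i = m + 1 := by omega
      simp [Nat.add_comm 1 m]

theorem eval_symN {m n : ℕ} (v : ℕ → CTerm S ℕ) {i : ℕ} (hi : i < n + m) :
    eval (.symN m n) v i = if i < n then v (m + i) else v (i - n) := by
  induction n generalizing v i with
  | zero =>
    rw [MTerm.symN, eval_cast, eval_idN _ (by omega)]
    simp
  | succ n ih =>
    rw [MTerm.symN, eval_seq, eval_cast, eval_par]
    split
    · rw [eval_idN _ ‹_›, eval_par, if_pos (by omega), ih _ (by omega), if_pos ‹_›,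
        if_pos (by omega)]
    · rw [eval_symOne _ (by omega)]
      simp only [eval_par]
      split
      · obtain rfl : i = n := by omega
        simp
      · rw [if_pos (by omega), ih _ (by omega), if_neg (by omega), if_neg (by omega)]
        congr 1
        omega

theorem eval_copyN {n : ℕ} (v : ℕ → CTerm S ℕ) {i : ℕ} (hi : i < n + n) :
    eval (copyN n) v i = if i < n then v i else v (i - n) := by
  induction n generalizing v i with
  | zero => omega
  | succ n ih =>
    rw [copyN, eval_seq, eval_cast, eval_par, eval_par, eval_id₁]
    simp only [eval_par]
    split
    · split
      · rw [eval_idN _ ‹_›, if_pos (by omega), eval_par, if_pos (by omega), ih _ (by omega),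
          if_pos ‹_›]
      · rw [eval_symN _ (by omega)]
        split
        · obtain rfl : i = n := by omega
          simp
        · rw [if_pos (by omega), ih _ (by omega), if_neg (by omega), if_neg (by omega)]
          congr 1
          omega
    · rw [if_neg (by omega), if_neg (by omega), eval_copy]
      congr 1
      omega

theorem eval_proj {n : ℕ} (j : Fin n) (v : ℕ → CTerm S ℕ) : eval (proj n j) v 0 = v j := by
  rw [proj, eval_cast]
  simp

theorem eval_tuple {n k : ℕ} (f : Fin k → MTerm S.withComonoid n 1) (v : ℕ → CTerm S ℕ)
    (i : Fin k) : eval (tuple k f) v i = eval (f i) v 0 := by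
  induction k with
  | zero => exact i.elim0
  | succ k ih =>
    rw [tuple, eval_seq, eval_par]
    induction i using Fin.lastCases with
    | last =>
      rw [if_neg (by simp), Fin.val_last, Nat.sub_self]
      refine eval_congr _ (fun i hi => ?_) Nat.one_pos
      rw [eval_copyN _ (by omega), if_neg (by omega), Nat.add_sub_cancel_left]
    | cast i =>
      rw [if_pos (by simp), Fin.val_castSucc, ← ih fun i => f i.castSucc]
      refine eval_congr _ (fun i hi => ?_) i.2
      rw [eval_copyN _ (by omega), if_pos hi]

theorem eval_toMonoidal {n : ℕ} (t : CTerm S (Fin n)) (v : ℕ → CTerm S ℕ) :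
    eval (toMonoidal t) v 0 = t.incl.subst v := by
  rw [CTerm.subst_incl]
  induction t with
  | var i => exact eval_proj i v
  | op o ts ih =>
    rw [toMonoidal, eval_seq, eval_opT, CTerm.subst]
    exact congrArg _ (funext fun i => (eval_tuple _ v i).trans (ih i))

/-- The interpretation of a monoidal term `n → m` as an `m`-tuple of cartesian terms in `n`
variables. -/
def interp : {n m : ℕ} → MTerm S.withComonoid n m → Fin m → CTerm S (Fin n)
  | _, _, .gen (ComonoidGen.op o), _ => .op o fun i => .var i
  | _, _, .gen ComonoidGen.copy, _ => .var (0 : Fin 1)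
  | _, _, .gen ComonoidGen.del, i => Fin.elim0 i
  | _, _, .id₁, i => .var i
  | _, _, .empty, i => .var i
  | _, _, .swap, i => .var i.rev
  | _, _, .seq s t, i => (interp t i).subst (interp s)
  | _, _, .par (n := n) (m := m) s t, i =>
      Fin.addCases (fun i => (interp s i).subst fun j => .var (Fin.castAdd m j))
        (fun i => (interp t i).subst fun j => .var (Fin.natAdd n j)) i

/-- `interp` is evaluation at the generic stream of variables. All properties of `interp` are
obtained from those of `eval` through this identity. -/
theorem incl_interp {n m : ℕ} (s : MTerm S.withComonoid n m) (i : Fin m) :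
    (interp s i).incl = eval s .var i := by
  induction s with
  | gen g =>
    cases g with
    | op o => rfl
    | copy => rfl
    | del => exact i.elim0
  | id₁ => rfl
  | empty => rfl
  | swap => fin_cases i <;> rfl
  | seq s t ihs iht =>
    rw [interp, CTerm.incl_subst, iht, eval_seq, eval_subst]
    refine eval_congr _ (fun j hj => ?_) i.2
    rw [← ihs ⟨j, hj⟩]
    simp only [CTerm.subst, CTerm.extend, dif_pos hj]
  | @par n n' m m' s t ihs iht =>
    rw [interp, eval_par]
    induction i using Fin.addCases with
    | left i =>
      rw [Fin.addCases_left, if_pos (by simp), Fin.val_castAdd, ← ihs, CTerm.incl,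
        CTerm.subst_subst]
      rfl
    | right i =>
      have h := congrArg (CTerm.subst fun j => .var (n + j)) (iht i)
      rw [Fin.addCases_right, if_neg (by simp), Fin.val_natAdd, Nat.add_sub_cancel_left]
      rw [eval_subst] at h
      refine Eq.trans ?_ h
      rw [CTerm.incl, CTerm.subst_subst, CTerm.subst_incl]
      rfl

theorem interp_idN {n : ℕ} (i : Fin n) : interp (S := S) (.idN n) i = .var i :=
  CTerm.incl_injective ((incl_interp _ i).trans (eval_idN _ i.2))

theorem interp_tuple {n m : ℕ} (f : Fin m → CTerm S (Fin n)) (i : Fin m) :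
    interp (tuple m fun i => toMonoidal (f i)) i = f i := by
  apply CTerm.incl_injective
  rw [incl_interp, eval_tuple, eval_toMonoidal, CTerm.subst_var]

end AlgSignature

/-! ### Soundness of evaluation for equational and quantitative derivations. -/

namespace QAlgTheory

open AlgSignature

variable {V : Type v} (U : QAlgTheory.{u} V)

theorem provable_eval_of_monEq {n m : ℕ} {s t : MTerm U.sig.withComonoid n m}
    (h : U.MonEq n m s t) (v : ℕ → CTerm U.sig ℕ) {i : ℕ} (hi : i < m) :
    U.Provable (eval s v i) (eval t v i) := by
  -- Only the translated axioms of the theory need a proof step, as substitution instances; the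
  -- comonoid and naturality equations evaluate to identical terms.
  suffices h' : (∃ (σ : ℕ → CTerm U.sig ℕ) (s' t' : CTerm U.sig ℕ), (s', t') ∈ U.eqs ∧
      eval s v i = s'.subst σ ∧ eval t v i = t'.subst σ) ∨ eval s v i = eval t v i by
    obtain ⟨σ, s', t', h, hs, ht⟩ | h' := h'
    · rw [hs, ht]
      exact .subst σ (.ax h)
    · rw [h']
      exact .refl _
  cases h with
  | ax s t h =>
    obtain rfl : i = 0 := by omega
    exact .inl ⟨v, _, _, h, eval_toMonoidal s v, eval_toMonoidal t v⟩
  | coassoc =>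
    right
    interval_cases i <;> simp
  | counit_left => exact .inr (by interval_cases i; simp)
  | counit_right => exact .inr (by interval_cases i; simp)
  | cocomm => exact .inr (by interval_cases i <;> simp)
  | copy_natural o =>
    right
    rw [eval_seq, eval_copy, eval_seq, eval_par, eval_opT]
    split
    · rw [eval_opT]
      congr 1
      funext j
      rw [eval_copyN _ (by omega), if_pos j.2]
    · rw [eval_opT]
      congr 1
      funext j
      rw [eval_copyN _ (by omega), if_neg (by omega), Nat.add_sub_cancel_left]
  | del_natural o => omega

theorem provable_eval_of_eqv {n m : ℕ} {s t : MTerm U.sig.withComonoid n m}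
    (h : U.toMonoidal.Eqv s t) (v : ℕ → CTerm U.sig ℕ) {i : ℕ} (hi : i < m) :
    U.Provable (eval s v i) (eval t v i) := by
  have of_eq {a b : CTerm U.sig ℕ} (h : a = b) : U.Provable a b := h ▸ .refl _
  induction h generalizing v i with
  | ax h => exact U.provable_eval_of_monEq h v hi
  | refl s => exact .refl _
  | symm _ ih => exact (ih v hi).symm
  | trans _ _ ih ih' => exact (ih v hi).trans (ih' v hi)
  | seq _ _ ih ih' =>
    exact .trans (eval_rel (fun o _ _ => .congr o) _ (fun i hi => ih v hi) hi) (ih' _ hi)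
  | par _ _ ih ih' =>
    rw [eval_par, eval_par]
    split
    · exact ih v ‹_›
    · exact ih' _ (by omega)
  | seq_assoc s t r => exact .refl _
  | id_seq s => exact of_eq (eval_congr s (fun i hi => eval_idN _ hi) hi)
  | seq_id s => exact of_eq (eval_idN _ hi)
  | @par_assoc n n' m m' l l' s t r =>
    apply of_eq
    rw [eval_cast]
    simp only [eval_par, Nat.add_assoc]
    split_ifs <;> first | rfl | omega | rw [Nat.sub_add_eq]
  | empty_par s => exact of_eq (by simp)
  | par_empty s => exact of_eq (by simp [hi])
  | interchange s t s' t' =>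
    apply of_eq
    simp only [eval_par, eval_seq]
    split
    · exact eval_congr t (fun j hj => by rw [eval_par, if_pos hj]) ‹_›
    · exact eval_congr t' (fun j hj => by simp) (by omega)
  | swap_swap =>
    apply of_eq
    rw [eval_idN _ hi]
    interval_cases i <;> simp
  | @sym_natural n n' m m' s t =>
    apply of_eq
    rw [eval_seq, eval_seq, eval_symN _ hi, eval_par, eval_par, eval_par]
    split
    · rw [if_neg (by omega), Nat.add_sub_cancel_left]
      exact eval_congr t (fun j hj => by rw [eval_symN _ (by omega), if_pos hj]) ‹_›
    · rw [if_pos (by omega)]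
      exact eval_congr s (fun j hj => by
        rw [eval_symN _ (by omega), if_neg (by omega), Nat.add_sub_cancel_left]) (by omega)

/-- The stream `v` is universally quantified in the induction because the second factor of a
composite is evaluated on the output of the first. -/
theorem qprovable_eval_of_closure [AddCommMonoid V] [CompleteLattice V] {n m : ℕ}
    {s t : MTerm U.toMonoidal.sig n m} {ε : V} (h : U.toMonoidal.Closure s t ε)
    (v : ℕ → CTerm U.sig ℕ) {i : ℕ} (hi : i < m) :
    U.QProvable (eval (S := U.sig) s v i) (eval (S := U.sig) t v i) ε := by
  induction h generalizing v i with
  | ax h =>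
    cases h with
    | ax s t ε h =>
      obtain rfl : i = 0 := by omega
      have h' := QProvable.subst v (.ax h)
      rwa [← eval_toMonoidal, ← eval_toMonoidal] at h'
  | refl h => exact .refl (U.provable_eval_of_eqv h v hi)
  | triang _ _ ih ih' => exact .triang (ih v hi) (ih' v hi)
  | bot s t => exact .bot _ _
  | mon _ h ih => exact .mon (ih v hi) h
  | join A _ ih => exact .cont A fun ε hε => ih ε hε v hi
  | seq_add _ _ ih ih' =>
    -- The intermediate point is the second diagram `t` applied to the output of `s'`. Changing the
    -- inputs of `t` costs no more than the distance of the inputs: being at a fixed distance is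
    -- compatible with operations, since a meet of copies of `ε` lies above `ε`. Changing `t` itself
    -- costs `ε'`.
    refine .triang (eval_rel (R := fun a b => U.QProvable a b _) (fun o _ _ h => ?_) _
      (fun i hi => ih v hi) hi) (ih' _ hi)
    exact .mon (.nexp o h) (le_iInf fun _ => le_rfl)
  | @par_inf n n' m m' s s' t t' ε ε' _ _ ih ih' =>
    change U.QProvable (if i < n' then eval (S := U.sig) s v i else eval (S := U.sig) t _ _)
      (if i < n' then eval (S := U.sig) s' v i else eval (S := U.sig) t' _ _) _
    split
    · exact .mon (ih v ‹_›) inf_le_left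
    · exact .mon (ih' _ (by omega)) inf_le_right

end QAlgTheory

/-! ### Diagrams with a natural cocommutative comonoid -/

open AlgSignature in
/-- The equations make every diagram a homomorphism for a cocommutative comonoid structure. -/
structure HasNaturalComonoid {S : AlgSignature.{u}}
    (E : ∀ n m : ℕ, Set (MTerm S.withComonoid n m × MTerm S.withComonoid n m)) : Prop where
  coassoc : MTerm.Eqv E (.seq copy (.par copy .id₁)) (.seq copy (.par .id₁ copy))
  counit_left : MTerm.Eqv E (.seq copy (.par del .id₁)) .id₁
  counit_right : MTerm.Eqv E (.seq copy (.par .id₁ del)) .id₁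
  cocomm : MTerm.Eqv E (.seq copy .swap) copy
  copy_natural (o : S.Op) : MTerm.Eqv E (.seq (opT o) copy)
    (.seq (copyN (S.ar o)) (.par (opT o) (opT o)))
  del_natural (o : S.Op) : MTerm.Eqv E (.seq (opT o) del) (delN (S.ar o))

namespace Diagram

variable {S : AlgSignature.{u}}
  {E : ∀ n m : ℕ, Set (MTerm S.withComonoid n m × MTerm S.withComonoid n m)}

/-- Copying one wire. -/
def copy : Diagram E := mk E AlgSignature.copy

/-- Deleting one wire. -/
def del : Diagram E := mk E AlgSignature.del

/-- Copying `n` wires. -/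
def copyN (n : ℕ) : Diagram E := mk E (AlgSignature.copyN n)

/-- Deleting `n` wires. -/
def delN (n : ℕ) : Diagram E := mk E (AlgSignature.delN n)

@[simp] theorem dom_copy : (copy : Diagram E).dom = 1 := by rfl
@[simp] theorem cod_copy : (copy : Diagram E).cod = 2 := by rfl
@[simp] theorem dom_del : (del : Diagram E).dom = 1 := by rfl
@[simp] theorem cod_del : (del : Diagram E).cod = 0 := by rfl
@[simp] theorem dom_copyN (n : ℕ) : (copyN n : Diagram E).dom = n := by rfl
@[simp] theorem cod_copyN (n : ℕ) : (copyN n : Diagram E).cod = n + n := by rfl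
@[simp] theorem dom_delN (n : ℕ) : (delN n : Diagram E).dom = n := by rfl
@[simp] theorem cod_delN (n : ℕ) : (delN n : Diagram E).cod = 0 := by rfl

theorem copyN_zero : (copyN 0 : Diagram E) = id 0 := rfl

theorem delN_zero : (delN 0 : Diagram E) = id 0 := rfl

theorem copyN_succ (n : ℕ) :
    (copyN (n + 1) : Diagram E) = (copyN n ⊠ copy) ⨾ (id n ⊠ sym n 1 ⊠ id 1) := by
  rw [copyN, AlgSignature.copyN, mk_seq, mk_cast, mk_par, mk_par, mk_par, ← id_one_eq, par_assoc]
  rfl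

theorem copyN_one : (copyN 1 : Diagram E) = copy := by
  rw [copyN_succ, copyN_zero, id_zero_par, id_zero_par, zero_sym_one, ← id_succ, seq_id]
  rfl

theorem delN_succ (n : ℕ) : (delN (n + 1) : Diagram E) = delN n ⊠ del := rfl

theorem delN_one : (delN 1 : Diagram E) = del := id_zero_par del

theorem delN_add (n m : ℕ) : (delN (n + m) : Diagram E) = delN n ⊠ delN m := by
  induction m with
  | zero => rw [delN_zero, par_id_zero, Nat.add_zero]
  | succ m ih => rw [← Nat.add_assoc, delN_succ, ih, par_assoc, delN_succ]

/-- Induction on `m`. The permutation in `copyN (n + m + 1)` splits by `sym_add_one` into a crossing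
with the `m` wires and one with the `n` wires (`h₂`). The former acts on wires disjoint from `sym n
m`, so it slides in front of it (`h₃`) and completes `copyN (m + 1)` (`h₄`); the latter merges with
`sym n m` into `sym n (m + 1)` (`h₅`). -/
theorem copyN_add (n m : ℕ) : (copyN (n + m) : Diagram E)
    = (copyN n ⊠ copyN m) ⨾ (id n ⊠ sym n m ⊠ id m) := by
  induction m with
  | zero =>
    rw [copyN_zero, par_id_zero, par_id_zero, sym_zero, ← id_add, Nat.add_zero, seq_id]
    rfl
  | succ m ih =>
    have h₁ : (copyN (n + m) ⊠ copy : Diagram E)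
        = (copyN n ⊠ copyN m ⊠ copy) ⨾ (id n ⊠ sym n m ⊠ id (m + 2)) := by
      rw [ih, id_add m 2]
      conv_lhs => rw [← seq_id (a := copy) cod_copy]
      rw [← par_seq_par]
      · simp only [par_assoc]
      all_goals simp
      omega
    have h₂ : (id (n + m) ⊠ sym (n + m) 1 ⊠ id 1 : Diagram E)
        = (id n ⊠ id (m + n) ⊠ sym m 1 ⊠ id 1)
          ⨾ (id n ⊠ id m ⊠ sym n 1 ⊠ id m ⊠ id 1) := by
      rw [sym_add_one, seq_par_id, id_par_seq]
      · simp only [id_add, par_assoc]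
      all_goals simp
      all_goals omega
    have h₃ : (id n ⊠ sym n m ⊠ id (m + 2) : Diagram E) ⨾ (id n ⊠ id (m + n) ⊠ sym m 1 ⊠ id 1)
        = (id n ⊠ id (n + m) ⊠ sym m 1 ⊠ id 1) ⨾ (id n ⊠ sym n m ⊠ id (m + 2)) := by
      rw [par_seq_par, par_seq_par, par_seq_par, par_seq_par, id_seq, seq_id, id_seq,
        seq_id, id_seq]
      all_goals simp
      all_goals omega
    have h₄ : (copyN n ⊠ copyN m ⊠ copy : Diagram E) ⨾ (id n ⊠ id (n + m) ⊠ sym m 1 ⊠ id 1)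
        = copyN n ⊠ copyN (m + 1) := by
      rw [copyN_succ, id_add n m, par_assoc, ← par_assoc (id n) (id n), ← id_add,
        par_seq_par, seq_id]
      all_goals simp
      all_goals omega
    have h₅ : (id n ⊠ sym n m ⊠ id (m + 2) : Diagram E)
          ⨾ (id n ⊠ id m ⊠ sym n 1 ⊠ id m ⊠ id 1)
        = id n ⊠ sym n (m + 1) ⊠ id (m + 1) := by
      rw [sym_succ n m, Nat.add_comm m 2, id_add 2 m, id_succ 1, par_assoc, ← id_add,
        Nat.add_comm 1 m,
        ← par_assoc (sym n m), ← par_assoc (id m) (sym n 1), ← id_succ, par_seq_par, par_seq_par,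
        seq_id, seq_id]
      all_goals simp
      all_goals omega
    rw [← Nat.add_assoc, copyN_succ, h₁, h₂, seq_assoc, ← seq_assoc (b := id n ⊠ id (m + n) ⊠ _),
      h₃, seq_assoc, h₅, ← seq_assoc, h₄]
    all_goals simp
    all_goals omega

/-- A diagram commutes with copying and deleting. -/
structure IsComonoidHom (a : Diagram E) : Prop where
  copy : a ⨾ copyN a.cod = copyN a.dom ⨾ (a ⊠ a)
  del : a ⨾ delN a.cod = delN a.dom

theorem IsComonoidHom.seq {a b : Diagram E} (h : a.cod = b.dom) (ha : a.IsComonoidHom)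
    (hb : b.IsComonoidHom) : (a ⨾ b).IsComonoidHom where
  copy := by
    rw [cod_seq h, dom_seq, seq_assoc h, hb.copy, ← seq_assoc, ← h, ha.copy, seq_assoc,
      par_seq_par h h]
    all_goals simp [h]
  del := by rw [cod_seq h, dom_seq, seq_assoc h (by simp), hb.del, ← h, ha.del]

/-- Copying a block of wires is copying both parts followed by a middle crossing (`copyN_add`), and
the crossing is natural. -/
theorem IsComonoidHom.par {a b : Diagram E} (ha : a.IsComonoidHom) (hb : b.IsComonoidHom) :
    (a ⊠ b).IsComonoidHom where
  copy := by
    have h : (a ⊠ a ⊠ b ⊠ b) ⨾ (id a.cod ⊠ sym a.cod b.cod ⊠ id b.cod)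
        = (id a.dom ⊠ sym a.dom b.dom ⊠ id b.dom) ⨾ (a ⊠ b ⊠ a ⊠ b) := by
      rw [← par_assoc a b b, ← par_assoc b a b, par_seq_par, par_seq_par, par_seq_par, par_seq_par,
        seq_id, seq_id, id_seq, id_seq, par_seq_sym]
      all_goals simp
    rw [cod_par, dom_par, copyN_add, copyN_add, ← seq_assoc, par_seq_par, ha.copy, hb.copy,
      ← par_seq_par, seq_assoc, par_assoc, h, par_assoc, seq_assoc]
    all_goals simp
    all_goals omega
  del := by
    rw [cod_par, dom_par, delN_add, delN_add, par_seq_par, ha.del, hb.del]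
    all_goals simp

theorem isComonoidHom_id_one : (id 1 : Diagram E).IsComonoidHom where
  copy := by
    rw [cod_id, dom_id, ← id_add, seq_id, id_seq]
    all_goals simp
  del := id_seq rfl

theorem isComonoidHom_id_zero : (id 0 : Diagram E).IsComonoidHom where
  copy := by
    rw [cod_id, dom_id, ← id_add, seq_id, id_seq]
    all_goals simp
  del := id_seq rfl

theorem sym_two_one : (sym 2 1 : Diagram E) = (id 1 ⊠ swap) ⨾ (swap ⊠ id 1) := by
  rw [sym_succ_one, sym_one_one]

theorem id_two : (id 2 : Diagram E) = id 1 ⊠ id 1 := id_succ 1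

theorem sym_two_two : (sym 2 2 : Diagram E)
    = (id 1 ⊠ swap ⊠ id 1) ⨾ (swap ⊠ swap) ⨾ (id 1 ⊠ swap ⊠ id 1) := by
  have h : (swap ⊠ swap : Diagram E) = (swap ⊠ id 2) ⨾ (id 2 ⊠ swap) := by
    rw [par_seq_par, seq_id, id_seq] <;> simp
  rw [sym_succ, sym_two_one, seq_par_id, id_par_seq, h, id_two]
  simp only [par_assoc]
  rw [seq_assoc, seq_assoc, seq_assoc]

  all_goals simp

/-- Naturality moves `swap` past the two copies as `sym 2 2`. By `sym_two_two` this is a pair of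
swaps between two middle crossings, the last of which cancels against the middle crossing inside
`copyN 2`. -/
theorem isComonoidHom_swap : (swap : Diagram E).IsComonoidHom where
  copy := by
    have h : (copyN 2 : Diagram E) = (copy ⊠ copy) ⨾ (id 1 ⊠ swap ⊠ id 1) := by
      rw [copyN_add 1 1, copyN_one, sym_one_one]
    have h' : (id 1 ⊠ swap ⊠ id 1 : Diagram E) ⨾ (id 1 ⊠ swap ⊠ id 1) = id 4 := by
      rw [par_seq_par, par_seq_par, swap_swap, seq_id, ← id_add, ← id_add]
      all_goals simp
    have h'' : (swap ⨾ (copy ⊠ copy) : Diagram E) = (copy ⊠ copy) ⨾ sym 2 2 := by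
      rw [par_seq_sym cod_copy cod_copy, dom_copy, sym_one_one]
    rw [cod_swap, dom_swap, h, ← seq_assoc, h'', sym_two_two, seq_assoc, seq_assoc, h', seq_id,
      ← seq_assoc]

    all_goals simp
  del := by
    rw [← sym_one_one]
    change sym 1 1 ⨾ delN 2 = delN 2
    rw [delN_add 1 1, delN_one]
    change sym (del : Diagram E).dom (del : Diagram E).dom ⨾ _ = _
    rw [← par_seq_sym cod_del cod_del, sym_zero, seq_id]
    simp

theorem copy_coassoc (hE : HasNaturalComonoid E) :
    (copy : Diagram E) ⨾ (copy ⊠ id 1) = copy ⨾ (id 1 ⊠ copy) := by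
  have h := mk_eq_mk.2 hE.coassoc
  rwa [mk_seq, mk_seq, mk_par, mk_par, ← id_one_eq] at h

theorem copy_del_left (hE : HasNaturalComonoid E) : (copy : Diagram E) ⨾ (del ⊠ id 1) = id 1 := by
  have h := mk_eq_mk.2 hE.counit_left
  rwa [mk_seq, mk_par, ← id_one_eq] at h

theorem copy_del_right (hE : HasNaturalComonoid E) : (copy : Diagram E) ⨾ (id 1 ⊠ del) = id 1 := by
  have h := mk_eq_mk.2 hE.counit_right
  rwa [mk_seq, mk_par, ← id_one_eq] at h

theorem copy_swap (hE : HasNaturalComonoid E) : (copy : Diagram E) ⨾ swap = copy := by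
  have h := mk_eq_mk.2 hE.cocomm
  rwa [mk_seq] at h

/-- Coassociativity rearranges the tree of copies so that the two middle wires come from a single
`copy`; cocommutativity then absorbs the crossing between them. -/
theorem isComonoidHom_copy (hE : HasNaturalComonoid E) : (copy : Diagram E).IsComonoidHom where
  copy := by
    have h : (copy ⨾ (copy ⊠ copy) : Diagram E)
        = copy ⨾ (id 1 ⊠ (copy ⨾ (copy ⊠ id 1))) := by
      have h₁ : (copy ⊠ copy : Diagram E) = (copy ⊠ id 1) ⨾ (id 2 ⊠ copy) := by
        rw [par_seq_par, seq_id, id_seq] <;> simp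
      rw [h₁, ← seq_assoc, copy_coassoc hE, id_two, par_assoc, seq_assoc, par_seq_par,
        seq_id (a := id 1)]
      all_goals simp
    rw [cod_copy, dom_copy, copyN_one, copyN_add 1 1, copyN_one, sym_one_one, ← seq_assoc, h,
      seq_assoc, par_seq_par, seq_assoc, par_seq_par, copy_swap hE, seq_id (a := id 1)]
    all_goals simp
  del := by
    rw [cod_copy, dom_copy, delN_add 1 1, delN_one]
    have h : (del ⊠ del : Diagram E) = (del ⊠ id 1) ⨾ (id 0 ⊠ del) := by
      rw [par_seq_par, seq_id, id_seq] <;> simp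
    rw [h, ← seq_assoc, copy_del_left hE, id_zero_par, id_seq]
    all_goals simp

theorem isComonoidHom_del (hE : HasNaturalComonoid E) : (del : Diagram E).IsComonoidHom where
  copy := by
    have h : (del ⊠ del : Diagram E) = (del ⊠ id 1) ⨾ (id 0 ⊠ del) := by
      rw [par_seq_par, seq_id, id_seq] <;> simp
    rw [cod_del, dom_del, copyN_one, h, ← seq_assoc, copy_del_left hE, id_zero_par, id_seq,
      copyN_zero, seq_id]
    all_goals simp
  del := by
    rw [cod_del, dom_del, delN_zero, delN_one, seq_id]
    simp

/-- Every diagram commutes with copying and deleting. -/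
theorem isComonoidHom (hE : HasNaturalComonoid E) (a : Diagram E) : a.IsComonoidHom := by
  obtain ⟨n, m, s, rfl⟩ := a.exists_mk
  induction s with
  | gen g =>
    cases g with
    | op o =>
      constructor
      · have h := mk_eq_mk.2 (hE.copy_natural o)
        rw [mk_seq, mk_seq, mk_par] at h
        refine Eq.trans ?_ h
        change _ ⨾ copyN 1 = _
        rw [copyN_one]
        rfl
      · have h := mk_eq_mk.2 (hE.del_natural o)
        rw [mk_seq] at h
        refine Eq.trans ?_ h
        change _ ⨾ delN 1 = _
        rw [delN_one]
        rfl
    | copy => exact isComonoidHom_copy hE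
    | del => exact isComonoidHom_del hE
  | id₁ =>
    rw [← id_one_eq]
    exact isComonoidHom_id_one
  | empty => exact isComonoidHom_id_zero
  | swap => exact isComonoidHom_swap
  | seq s t ihs iht =>
    rw [mk_seq]
    exact ihs.seq rfl iht
  | par s t ihs iht => exact ihs.par iht

/-! ### Counit laws on `n` wires, projections and extensionality. -/

theorem copyN_del_left (hE : HasNaturalComonoid E) (n : ℕ) :
    (copyN n : Diagram E) ⨾ (delN n ⊠ id n) = id n := by
  induction n with
  | zero =>
    rw [copyN_zero, delN_zero, id_zero_par, seq_id]
    rfl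
  | succ n ih =>
    have h : (sym n 1 : Diagram E) ⨾ (del ⊠ id n) = id n ⊠ del := by
      have h := (par_seq_sym (a := (id n : Diagram E)) (b := del) rfl rfl).symm
      rwa [dom_id, dom_del, cod_id, cod_del, sym_zero, seq_id (by simp)] at h
    have h' : (id n ⊠ sym n 1 ⊠ id 1 : Diagram E) ⨾ (delN (n + 1) ⊠ id (n + 1))
        = (delN n ⊠ id n) ⊠ del ⊠ id 1 := by
      rw [delN_succ, id_succ n, par_assoc (delN n), ← par_assoc del (id n), par_seq_par, par_seq_par, h,
        id_seq, id_seq]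
      · simp only [par_assoc]
      all_goals simp
    rw [copyN_succ, seq_assoc, h', par_seq_par, ih, copy_del_left hE, ← id_succ]
    all_goals simp
    all_goals omega

theorem copyN_del_right (hE : HasNaturalComonoid E) (n : ℕ) :
    (copyN n : Diagram E) ⨾ (id n ⊠ delN n) = id n := by
  induction n with
  | zero =>
    rw [copyN_zero, delN_zero, id_zero_par, seq_id]
    rfl
  | succ n ih =>
    have h : (sym n 1 : Diagram E) ⨾ (id 1 ⊠ delN n) = delN n ⊠ id 1 := by
      have h := (par_seq_sym (a := (delN n : Diagram E)) (b := id 1) rfl rfl).symm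
      rwa [dom_id, dom_delN, cod_id, cod_delN, zero_sym_one, seq_id (by simp)] at h
    have h' : (id n ⊠ sym n 1 ⊠ id 1 : Diagram E) ⨾ (id (n + 1) ⊠ delN (n + 1))
        = (id n ⊠ delN n) ⊠ id 1 ⊠ del := by
      rw [delN_succ, id_succ n, par_assoc (id n), ← par_assoc (id 1) (delN n), par_seq_par,
        par_seq_par, h,
        id_seq, id_seq]
      · simp only [par_assoc]
      all_goals simp
    rw [copyN_succ, seq_assoc, h', par_seq_par, ih, copy_del_right hE, ← id_succ]
    all_goals simp
    all_goals omega

theorem copyN_par_delN (hE : HasNaturalComonoid E) {a : Diagram E} {n : ℕ} (h : n = a.dom) :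
    copyN n ⨾ (a ⊠ delN n) = a := by
  have h' : a ⊠ delN n = (id n ⊠ delN n) ⨾ a := by
    conv_rhs => rw [← par_id_zero a]
    rw [par_seq_par, id_seq h, seq_id]
    all_goals simp [h]
  rw [h', ← seq_assoc, copyN_del_right hE, id_seq h]
  all_goals simp [h]

theorem copyN_delN_par (hE : HasNaturalComonoid E) {a : Diagram E} {n : ℕ} (h : n = a.dom) :
    copyN n ⨾ (delN n ⊠ a) = a := by
  have h' : delN n ⊠ a = (delN n ⊠ id n) ⨾ a := by
    conv_rhs => rw [← id_zero_par a]
    rw [par_seq_par, id_seq h, seq_id]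
    all_goals simp [h]
  rw [h', ← seq_assoc, copyN_del_left hE, id_seq h]
  all_goals simp [h]

/-- The crossing inside `copyN (n + m)` slides past the deletions, leaving one counit law on each
block. -/
theorem copyN_projections (hE : HasNaturalComonoid E) (n m : ℕ) :
    (copyN (n + m) : Diagram E) ⨾ ((id n ⊠ delN m) ⊠ (delN n ⊠ id m)) = id (n + m) := by
  have h : (sym n m : Diagram E) ⨾ (delN m ⊠ delN n) = delN n ⊠ delN m := by
    have h := (par_seq_sym (a := (delN n : Diagram E)) (b := delN m) rfl rfl).symm
    rwa [cod_delN, cod_delN, sym_zero, seq_id (by simp)] at h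
  have h' : (id n ⊠ sym n m ⊠ id m : Diagram E) ⨾ ((id n ⊠ delN m) ⊠ (delN n ⊠ id m))
      = (id n ⊠ delN n) ⊠ (delN m ⊠ id m) := by
    rw [par_assoc, par_assoc, ← par_assoc (delN m), ← par_assoc (delN n), par_seq_par, par_seq_par,
      h, id_seq, id_seq]
    all_goals simp
  rw [copyN_add, seq_assoc, h', par_seq_par, copyN_del_left hE, copyN_del_right hE, id_add]
  all_goals simp
  all_goals omega

/-- The pairing of two projections is the identity by `copyN_projections`; naturality of copying
moves the diagram `a` inside the pairing. This is the uniqueness half of the universal property of a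
product. -/
theorem eq_copyN_seq (hE : HasNaturalComonoid E) {a : Diagram E} {n m : ℕ} (h : a.cod = n + m) :
    a = copyN a.dom ⨾ ((a ⨾ (id n ⊠ delN m)) ⊠ (a ⨾ (delN n ⊠ id m))) := by
  rw [← par_seq_par, ← seq_assoc, ← (isComonoidHom hE a).copy, seq_assoc, h,
    copyN_projections hE, seq_id h]
  all_goals simp [h]

/-- The `i`-th of `n` wires, with all others deleted. -/
def proj (n : ℕ) (i : Fin n) : Diagram E := mk E (AlgSignature.proj n i)

@[simp] theorem dom_proj (n : ℕ) (i : Fin n) : (proj n i : Diagram E).dom = n := by rfl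
@[simp] theorem cod_proj (n : ℕ) (i : Fin n) : (proj n i : Diagram E).cod = 1 := by rfl

theorem proj_eq (n : ℕ) (i : Fin n) :
    (proj n i : Diagram E) = delN i ⊠ id 1 ⊠ delN (n - 1 - i) := by
  rw [proj, AlgSignature.proj, mk_cast, mk_par, mk_par, ← id_one_eq, par_assoc]
  rfl

theorem proj_last (n : ℕ) : (proj (n + 1) (Fin.last n) : Diagram E) = delN n ⊠ id 1 := by
  rw [proj_eq, Fin.val_last, Nat.add_sub_cancel, Nat.sub_self, delN_zero, par_id_zero]

theorem proj_castSucc (n : ℕ) (i : Fin n) :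
    (proj (n + 1) i.castSucc : Diagram E) = proj n i ⊠ del := by
  rw [proj_eq, proj_eq, Fin.val_castSucc, show n + 1 - 1 - i.val = n - 1 - i.val + 1 by omega,
    delN_succ, par_assoc, par_assoc]

theorem proj_one (i : Fin 1) : (proj 1 i : Diagram E) = id 1 := by
  obtain rfl : i = Fin.last 0 := Subsingleton.elim _ _
  rw [proj_last, delN_zero, id_zero_par]

theorem proj_castAdd (n m : ℕ) (i : Fin n) :
    (proj (n + m) (Fin.castAdd m i) : Diagram E) = proj n i ⊠ delN m := by
  rw [proj_eq, proj_eq, Fin.val_castAdd, show n + m - 1 - i.val = n - 1 - i.val + m by omega,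
    delN_add, par_assoc, par_assoc]

theorem proj_natAdd (n m : ℕ) (i : Fin m) :
    (proj (n + m) (Fin.natAdd n i) : Diagram E) = delN n ⊠ proj m i := by
  rw [proj_eq, proj_eq, Fin.val_natAdd, delN_add, par_assoc,
    show n + m - 1 - (n + i.val) = m - 1 - i.val by omega]

/-- Two diagrams are equal if all their components are. -/
theorem ext_proj (hE : HasNaturalComonoid E) {m : ℕ} {a b : Diagram E} (hd : a.dom = b.dom)
    (ha : a.cod = m) (hb : b.cod = m) (h : ∀ i, a ⨾ proj m i = b ⨾ proj m i) : a = b := by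
  induction m generalizing a b with
  | zero =>
    -- The object `0` is terminal: naturality of deletion forces a diagram without outputs to delete
    -- its inputs.
    have h (c : Diagram E) (hc : c.cod = 0) : c = delN c.dom := by
      rw [← (isComonoidHom hE c).del, hc, delN_zero, seq_id hc]
    rw [h a ha, h b hb, hd]
  | succ m ih =>
    -- Split the outputs as `m + 1`: the induction hypothesis treats the first `m`, and the
    -- hypothesis at `Fin.last m` treats the remaining one.
    have h₁ : a ⨾ (id m ⊠ del) = b ⨾ (id m ⊠ del) := by
      refine ih (by simpa) (by simp [ha]) (by simp [hb]) fun i => ?_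
      have hi : (id m ⊠ del : Diagram E) ⨾ proj m i = proj (m + 1) i.castSucc := by
        conv_lhs => rw [← par_id_zero (proj m i)]
        rw [par_seq_par, id_seq, seq_id, proj_castSucc]
        all_goals simp
      rw [seq_assoc, seq_assoc, hi, h]
      all_goals simp [ha, hb]
    rw [eq_copyN_seq hE ha, eq_copyN_seq hE hb, hd, delN_one, h₁, ← proj_last, h]

/-! ### Tuples, substitution and the components of a diagram. -/

theorem mk_tuple_succ {n k : ℕ} (f : Fin (k + 1) → MTerm S.withComonoid n 1) :
    mk E (AlgSignature.tuple (k + 1) f)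
      = copyN n ⨾ (mk E (AlgSignature.tuple k fun i => f i.castSucc) ⊠ mk E (f (Fin.last k))) := by
  rw [AlgSignature.tuple, mk_seq, mk_par]
  rfl

/-- The existence half of the universal property: the discarded components turn into deletions of
their inputs, which the counit laws remove. -/
theorem mk_tuple_seq_proj (hE : HasNaturalComonoid E) {n k : ℕ}
    (f : Fin k → MTerm S.withComonoid n 1) (i : Fin k) :
    mk E (AlgSignature.tuple k f) ⨾ proj k i = mk E (f i) := by
  induction k with
  | zero => exact i.elim0
  | succ k ih =>
    rw [mk_tuple_succ, seq_assoc (by simp) (by simp)]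
    induction i using Fin.lastCases with
    | last =>
      have h := (isComonoidHom hE (mk E (AlgSignature.tuple k fun i => f i.castSucc))).del
      rw [cod_mk, dom_mk] at h
      rw [proj_last, par_seq_par, h, seq_id, copyN_delN_par hE]
      all_goals simp
    | cast i =>
      have h := (isComonoidHom hE (mk E (f (Fin.last k)))).del
      rw [cod_mk, dom_mk, delN_one] at h
      rw [proj_castSucc, par_seq_par, h, ih, copyN_par_delN hE]
      all_goals simp

theorem seq_mk_tuple (hE : HasNaturalComonoid E) {n m k : ℕ} {s : MTerm S.withComonoid n m}
    {f : Fin k → MTerm S.withComonoid m 1} {g : Fin k → MTerm S.withComonoid n 1}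
    (h : ∀ i, mk E s ⨾ mk E (f i) = mk E (g i)) :
    mk E s ⨾ mk E (AlgSignature.tuple k f) = mk E (AlgSignature.tuple k g) := by
  refine ext_proj hE (m := k) (by simp) (by simp) (by simp) fun i => ?_
  rw [seq_assoc (by simp) (by simp), mk_tuple_seq_proj hE, mk_tuple_seq_proj hE, h]

theorem mk_tuple_congr (hE : HasNaturalComonoid E) {n k : ℕ}
    {f g : Fin k → MTerm S.withComonoid n 1} (h : ∀ i, mk E (f i) = mk E (g i)) :
    mk E (AlgSignature.tuple k f) = mk E (AlgSignature.tuple k g) := by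
  refine ext_proj hE (m := k) (by simp) (by simp) (by simp) fun i => ?_
  rw [mk_tuple_seq_proj hE, mk_tuple_seq_proj hE, h]

open AlgSignature (toMonoidal tuple opT interp)

theorem mk_toMonoidal_op {n : ℕ} (o : S.Op) (ts : Fin (S.ar o) → CTerm S (Fin n)) :
    mk E (toMonoidal (.op o ts))
      = mk E (tuple (S.ar o) fun i => toMonoidal (ts i)) ⨾ mk E (opT o) :=
  mk_seq _ _

/-- Precomposition with a diagram is substitution of its components. -/
theorem seq_mk_toMonoidal (hE : HasNaturalComonoid E) {n m : ℕ} {s : MTerm S.withComonoid n m}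
    {σ : Fin m → CTerm S (Fin n)} (h : ∀ i, mk E s ⨾ proj m i = mk E (toMonoidal (σ i)))
    (t : CTerm S (Fin m)) : mk E s ⨾ mk E (toMonoidal t) = mk E (toMonoidal (t.subst σ)) := by
  induction t with
  | var i => exact h i
  | op o ts ih =>
    rw [CTerm.subst, mk_toMonoidal_op, mk_toMonoidal_op, ← seq_assoc (by simp) (by simp),
      seq_mk_tuple hE ih]

theorem mk_toMonoidal_subst (hE : HasNaturalComonoid E) {n m : ℕ} (σ : Fin m → CTerm S (Fin n))
    (t : CTerm S (Fin m)) : mk E (toMonoidal (t.subst σ))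
      = mk E (tuple m fun i => toMonoidal (σ i)) ⨾ mk E (toMonoidal t) :=
  (seq_mk_toMonoidal hE (mk_tuple_seq_proj hE _) t).symm

/-- The components of a monoidal term represent its interpretation. -/
theorem mk_seq_proj (hE : HasNaturalComonoid E) {n m : ℕ} (s : MTerm S.withComonoid n m)
    (i : Fin m) : mk E s ⨾ proj m i = mk E (toMonoidal (interp s i)) := by
  induction s with
  | gen g =>
    cases g with
    | op o =>
      -- The tuple of all projections is the identity, so the representation of `o` applied to
      -- variables reduces to the generator `o`.
      have h : mk E (tuple (S.ar o) fun i => toMonoidal (.var i)) = id (S.ar o) := by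
        refine ext_proj hE (m := S.ar o) (by simp) (by simp) (by simp) fun i => ?_
        rw [mk_tuple_seq_proj hE, id_seq (by simp)]
        rfl
      change Fin 1 at i
      refine Eq.trans ?_ (mk_toMonoidal_op o _).symm
      change mk E (opT o) ⨾ proj 1 i = mk E (tuple (S.ar o) fun i => toMonoidal (.var i)) ⨾ _
      rw [h, id_seq (by simp), proj_one, seq_id (by simp)]
    | copy =>
      change copy ⨾ proj 2 i = proj 1 0
      rw [proj_one]
      induction i using Fin.lastCases with
      | last =>
        change copy ⨾ proj (1 + 1) (Fin.last 1) = _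
        rw [proj_last, delN_one, copy_del_left hE]
      | cast i =>
        change copy ⨾ proj (1 + 1) (Fin.castSucc i) = _
        rw [proj_castSucc, proj_one, copy_del_right hE]
    | del => exact i.elim0
  | id₁ =>
    change mk E .id₁ ⨾ proj 1 i = proj 1 i
    rw [← id_one_eq, id_seq (by simp)]
  | empty => exact i.elim0
  | swap =>
    induction i using Fin.lastCases with
    | last =>
      change swap ⨾ proj (1 + 1) (Fin.last 1) = proj (1 + 1) (Fin.castSucc 0)
      have h := (par_seq_sym (a := (id 1 : Diagram E)) (b := del) rfl rfl).symm
      rw [dom_id, dom_del, cod_id, cod_del, sym_zero, sym_one_one, seq_id (by simp)] at h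
      rw [proj_last, proj_castSucc, proj_one, delN_one, h]
    | cast i =>
      obtain rfl : i = 0 := Subsingleton.elim _ _
      change swap ⨾ proj (1 + 1) (Fin.castSucc 0) = proj (1 + 1) (Fin.last 1)
      have h := (par_seq_sym (a := (del : Diagram E)) (b := id 1) rfl rfl).symm
      rw [dom_id, dom_del, cod_id, cod_del, zero_sym_one, sym_one_one, seq_id (by simp)] at h
      rw [proj_last, proj_castSucc, proj_one, delN_one, h]
  | seq s t ihs iht =>
    rw [mk_seq, seq_assoc (by simp) (by simp), iht, seq_mk_toMonoidal hE ihs]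
    rfl
  | @par n n' m m' s t ihs iht =>
    rw [mk_par, interp]
    induction i using Fin.addCases with
    | left i =>
      -- Projecting to an output of `s` discards `t`, which becomes the deletion of its `m` inputs.
      -- The remaining diagram is weakening by `m` variables, realised by precomposition with `id n
      -- ⊠ delN m`.
      have ht := (isComonoidHom hE (mk E t)).del
      rw [cod_mk, dom_mk] at ht
      rw [Fin.addCases_left, proj_castAdd, par_seq_par (by simp) (by simp), ihs, ht,
        ← seq_mk_toMonoidal hE
          (s := .cast rfl (Nat.add_zero n) (.par (.idN n) (AlgSignature.delN m)))
          (σ := fun j => .var (Fin.castAdd m j))]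
      · rw [mk_cast]
        change _ = (id n ⊠ delN m) ⨾ _
        conv_rhs => rw [← par_id_zero (mk E _)]
        rw [par_seq_par, id_seq, seq_id]
        all_goals simp
      · intro j
        rw [mk_cast]
        change (id n ⊠ delN m) ⨾ proj n j = proj (n + m) (Fin.castAdd m j)
        conv_lhs => rw [← par_id_zero (proj n j)]
        rw [par_seq_par, id_seq, seq_id, proj_castAdd]
        all_goals simp
    | right i =>
      have hs := (isComonoidHom hE (mk E s)).del
      rw [cod_mk, dom_mk] at hs
      rw [Fin.addCases_right, proj_natAdd, par_seq_par (by simp) (by simp), iht, hs,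
        ← seq_mk_toMonoidal hE
          (s := .cast rfl (Nat.zero_add m) (.par (AlgSignature.delN n) (.idN m)))
          (σ := fun j => .var (Fin.natAdd n j))]
      · rw [mk_cast]
        change _ = (delN n ⊠ id m) ⨾ _
        conv_rhs => rw [← id_zero_par (mk E _)]
        rw [par_seq_par, id_seq, seq_id]
        all_goals simp
      · intro j
        rw [mk_cast]
        change (delN n ⊠ id m) ⨾ proj m j = proj (n + m) (Fin.natAdd n j)
        conv_lhs => rw [← id_zero_par (proj m j)]
        rw [par_seq_par, id_seq, seq_id, proj_natAdd]
        all_goals simp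

/-- Every monoidal term is the tuple of its interpretation. -/
theorem mk_tuple_interp (hE : HasNaturalComonoid E) {n m : ℕ} (s : MTerm S.withComonoid n m) :
    mk E (tuple m fun i => toMonoidal (interp s i)) = mk E s := by
  refine ext_proj hE (m := m) (by simp) (by simp) (by simp) fun i => ?_
  rw [mk_tuple_seq_proj hE, mk_seq_proj hE]

end Diagram

/-! ### Translating derivations -/

/-- The statement covers every `m ≥ N`, and not one `m`, so that finitely many terms can be placed
in a common context. -/
theorem CTerm.exists_incl_eq {S : AlgSignature.{u}} (t : CTerm S ℕ) :
    ∃ N, ∀ m ≥ N, ∃ t' : CTerm S (Fin m), t'.incl = t := by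
  induction t with
  | var k => exact ⟨k + 1, fun m hm => ⟨.var ⟨k, hm⟩, rfl⟩⟩
  | op o ts ih =>
    choose N hN using ih
    refine ⟨Finset.univ.sup N, fun m hm => ?_⟩
    choose t' ht' using fun i => hN i m ((Finset.le_sup (Finset.mem_univ i)).trans hm)
    exact ⟨.op o t', congrArg (op o) (funext ht')⟩

theorem CTerm.exists_incl_eq_pair {S : AlgSignature.{u}} (s t : CTerm S ℕ) :
    ∃ (m : ℕ) (s' t' : CTerm S (Fin m)), s'.incl = s ∧ t'.incl = t := by
  obtain ⟨N, hN⟩ := s.exists_incl_eq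
  obtain ⟨M, hM⟩ := t.exists_incl_eq
  obtain ⟨s', hs⟩ := hN _ (le_max_left N M)
  obtain ⟨t', ht⟩ := hM _ (le_max_right N M)
  exact ⟨_, s', t', hs, ht⟩

/-- A substitution of terms in `n` variables that is the identity on the first `n` variables. -/
def CTerm.retract {S : AlgSignature.{u}} {n : ℕ} (d : CTerm S (Fin n)) (k : ℕ) :
    CTerm S (Fin n) := if h : k < n then var ⟨k, h⟩ else d

theorem CTerm.incl_subst_retract {S : AlgSignature.{u}} {n : ℕ} (d t : CTerm S (Fin n)) :
    t.incl.subst (retract d) = t := by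
  rw [subst_incl]
  simp only [retract, Fin.is_lt, dite_true]
  exact subst_var t

namespace QAlgTheory

open AlgSignature (tuple opT interp)
open Diagram (mk_eq_mk)

variable {V : Type v} (U : QAlgTheory.{u} V)

/-- The equations of the monoidal counterpart. -/
def monEqs (n m : ℕ) : Set (MTerm U.sig.withComonoid n m × MTerm U.sig.withComonoid n m) :=
  {p | U.MonEq n m p.1 p.2}

theorem hasNaturalComonoid : HasNaturalComonoid U.monEqs where
  coassoc := .ax .coassoc
  counit_left := .ax .counit_left
  counit_right := .ax .counit_right
  cocomm := .ax .cocomm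
  copy_natural o := .ax (.copy_natural o)
  del_natural o := .ax (.del_natural o)

theorem eqv_of_mk_eq_mk {n m : ℕ} {s t : MTerm U.sig.withComonoid n m}
    (h : Diagram.mk U.monEqs s = Diagram.mk U.monEqs t) :
    U.toMonoidal.Eqv (n := n) (m := m) s t := mk_eq_mk.1 h

/-- A derivation between terms in `n` variables may pass through terms with further variables, so
the induction cannot stay in a fixed context. Quantifying over all substitutions into `n` variables
removes the problem and makes the substitution rule immediate. -/
theorem Provable.mk_toMonoidal_subst {s t : CTerm U.sig ℕ} (h : U.Provable s t) {n : ℕ}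
    (σ : ℕ → CTerm U.sig (Fin n)) :
    Diagram.mk U.monEqs (AlgSignature.toMonoidal (s.subst σ))
      = Diagram.mk U.monEqs (AlgSignature.toMonoidal (t.subst σ)) := by
  have hE := U.hasNaturalComonoid
  induction h generalizing n with
  | @ax s t h =>
    obtain ⟨m, s', t', rfl, rfl⟩ := s.exists_incl_eq_pair t
    rw [CTerm.subst_incl, CTerm.subst_incl, Diagram.mk_toMonoidal_subst hE,
      Diagram.mk_toMonoidal_subst hE, mk_eq_mk.2 (MTerm.Eqv.ax (E := U.monEqs) (MonEq.ax s' t' h))]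
  | refl s => rfl
  | symm _ ih => exact (ih σ).symm
  | trans _ _ ih ih' => exact (ih σ).trans (ih' σ)
  | subst τ _ ih =>
    rw [CTerm.subst_subst, CTerm.subst_subst]
    exact ih _
  | congr o _ ih =>
    change Diagram.mk _ (AlgSignature.toMonoidal (.op o _))
      = Diagram.mk _ (AlgSignature.toMonoidal (.op o _))
    rw [Diagram.mk_toMonoidal_op, Diagram.mk_toMonoidal_op,
      Diagram.mk_tuple_congr hE fun i => ih i σ]

theorem Provable.mk_toMonoidal {n : ℕ} {s t : CTerm U.sig (Fin n)}
    (h : U.Provable s.incl t.incl) :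
    Diagram.mk U.monEqs (AlgSignature.toMonoidal s)
      = Diagram.mk U.monEqs (AlgSignature.toMonoidal t) := by
  -- Variables outside the context are sent to `s`: for `n = 0` there may be no variable or constant
  -- to use, but `s` itself is a term in the context.
  have h := Provable.mk_toMonoidal_subst U h (.retract s)
  rwa [CTerm.incl_subst_retract, CTerm.incl_subst_retract] at h

/-- The tuple of monoidal terms representing a tuple of cartesian terms. -/
def tupleTerm {n m : ℕ} (f : Fin m → CTerm U.sig (Fin n)) : MTerm U.toMonoidal.sig n m :=
  tuple m fun i => AlgSignature.toMonoidal (f i)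

/-- The interpretation of a monoidal term as a tuple of cartesian terms. -/
def interpTerm {n m : ℕ} (s : MTerm U.toMonoidal.sig n m) : Fin m → CTerm U.sig (Fin n) :=
  interp (S := U.sig) s

theorem tupleTerm_eqv {n m : ℕ} {f g : Fin m → CTerm U.sig (Fin n)}
    (h : ∀ i, U.Provable (f i).incl (g i).incl) :
    U.toMonoidal.Eqv (U.tupleTerm f) (U.tupleTerm g) :=
  U.eqv_of_mk_eq_mk (Diagram.mk_tuple_congr U.hasNaturalComonoid
    fun i => Provable.mk_toMonoidal U (h i))

theorem interpTerm_provable {n m : ℕ} {s t : MTerm U.toMonoidal.sig n m}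
    (h : U.toMonoidal.Eqv s t) (i : Fin m) :
    U.Provable (U.interpTerm s i).incl (U.interpTerm t i).incl := by
  have h := U.provable_eval_of_eqv h .var i.2
  rw [← AlgSignature.incl_interp (S := U.sig) s i, ← AlgSignature.incl_interp (S := U.sig) t i] at h
  exact h

theorem tupleTerm_subst {n m l : ℕ} (f : Fin m → CTerm U.sig (Fin n))
    (g : Fin l → CTerm U.sig (Fin m)) :
    U.toMonoidal.Eqv (U.tupleTerm fun i => (g i).subst f)
      ((U.tupleTerm f).seq (U.tupleTerm g)) := by
  have h := Diagram.seq_mk_tuple U.hasNaturalComonoid fun i =>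
    (Diagram.mk_toMonoidal_subst U.hasNaturalComonoid f (g i)).symm
  rw [← Diagram.mk_seq] at h
  exact U.eqv_of_mk_eq_mk h.symm

theorem tupleTerm_interpTerm {n m : ℕ} (s : MTerm U.toMonoidal.sig n m) :
    U.toMonoidal.Eqv (U.tupleTerm (U.interpTerm s)) s :=
  U.eqv_of_mk_eq_mk (Diagram.mk_tuple_interp U.hasNaturalComonoid s)

theorem interpTerm_tupleTerm {n m : ℕ} (f : Fin m → CTerm U.sig (Fin n)) :
    U.interpTerm (U.tupleTerm f) = f := funext fun i => AlgSignature.interp_tuple f i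

/-- The functor sending a tuple of cartesian terms to its monoidal representation. -/
def toSyn : U.LT ⥤ U.toMonoidal.Syn where
  obj n := n
  map {n m} := Quotient.map (sa := U.setoid n m) (sb := U.toMonoidal.setoid n m) U.tupleTerm
    fun _ _ h => U.tupleTerm_eqv h
  map_id n := Quotient.sound (by
    have h := U.tupleTerm_interpTerm (MTerm.idN n)
    rwa [show U.interpTerm (MTerm.idN n) = CTerm.var from funext AlgSignature.interp_idN] at h)
  map_comp := by
    rintro n m l ⟨f⟩ ⟨g⟩
    exact Quotient.sound (U.tupleTerm_subst f g)

/-- The functor interpreting monoidal terms as tuples of cartesian terms. -/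
def ofSyn : U.toMonoidal.Syn ⥤ U.LT where
  obj n := n
  map {n m} := Quotient.map (sa := U.toMonoidal.setoid n m) (sb := U.setoid n m) U.interpTerm
    fun _ _ h => U.interpTerm_provable h
  map_id n := congrArg (Quotient.mk (U.setoid n n)) (funext AlgSignature.interp_idN)
  map_comp := by
    rintro n m l ⟨s⟩ ⟨t⟩
    rfl

/-! ### Quantitative derivations in the monoidal counterpart and the isometry. -/

variable [AddCommMonoid V] [CompleteLattice V]

/-- The quantitative equations derivable in the monoidal counterpart. -/
def MonClosure {n m : ℕ} (s t : MTerm U.sig.withComonoid n m) (ε : V) : Prop :=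
  U.toMonoidal.Closure (n := n) (m := m) s t ε

variable {U}

theorem MonClosure.of_eq {n m : ℕ} {s t : MTerm U.sig.withComonoid n m}
    (h : Diagram.mk U.monEqs s = Diagram.mk U.monEqs t) (ε : V) : U.MonClosure s t ε :=
  .mon (.refl (U.eqv_of_mk_eq_mk h)) le_top

/-- Provable equalities hold at distance `⊤`, hence also at the unit `0`; at that value the triangle
rule leaves `ε` unchanged. -/
theorem MonClosure.congr {n m : ℕ} {s s' t t' : MTerm U.sig.withComonoid n m} {ε : V}
    (h : U.MonClosure s t ε) (hs : Diagram.mk U.monEqs s' = Diagram.mk U.monEqs s)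
    (ht : Diagram.mk U.monEqs t' = Diagram.mk U.monEqs t) : U.MonClosure s' t' ε := by
  have h' := QMonTheory.Closure.triang (.triang (MonClosure.of_eq hs 0) h)
    (MonClosure.of_eq ht.symm 0)
  rwa [zero_add, add_zero] at h'

theorem MonClosure.seq_right {n m l : ℕ} {s s' : MTerm U.sig.withComonoid n m} {ε : V}
    (h : U.MonClosure s s' ε) (t : MTerm U.sig.withComonoid m l) :
    U.MonClosure (s.seq t) (s'.seq t) ε := by
  have h' := QMonTheory.Closure.seq_add h (MonClosure.of_eq (s := t) rfl 0)
  rwa [add_zero] at h'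

theorem MonClosure.seq_left {n m l : ℕ} (s : MTerm U.sig.withComonoid n m)
    {t t' : MTerm U.sig.withComonoid m l} {ε : V} (h : U.MonClosure t t' ε) :
    U.MonClosure (s.seq t) (s.seq t') ε := by
  have h' := QMonTheory.Closure.seq_add (MonClosure.of_eq (s := s) rfl 0) h
  rwa [zero_add] at h'

/-- No distance is lost however large `k` is: each copying stage is fixed and contributes `0` to the
sum, and the components are joined by `Par_⊓`, where `ε ⊓ ε` is `ε`. -/
theorem MonClosure.tuple {n k : ℕ} {f g : Fin k → MTerm U.sig.withComonoid n 1} {ε : V}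
    (h : ∀ i, U.MonClosure (f i) (g i) ε) :
    U.MonClosure (AlgSignature.tuple k f) (AlgSignature.tuple k g) ε := by
  induction k with
  | zero => exact .of_eq rfl ε
  | succ k ih =>
    refine .seq_left _ (.mon (QMonTheory.Closure.par_inf (ih fun i => h i.castSucc)
      (h (Fin.last k))) (le_inf le_rfl le_rfl))

/-- As for provable equality, the substitution is general so that the context may change during the
derivation. An axiom instance is the translated axiom precomposed with the tuple of `σ`; for an
operation, the distances of the arguments are first weakened to their meet. -/
theorem QProvable.monClosure_subst {s t : CTerm U.sig ℕ} {ε : V} (h : U.QProvable s t ε) {n : ℕ}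
    (σ : ℕ → CTerm U.sig (Fin n)) :
    U.MonClosure (AlgSignature.toMonoidal (s.subst σ)) (AlgSignature.toMonoidal (t.subst σ)) ε := by
  have hE := U.hasNaturalComonoid
  induction h generalizing n with
  | @ax s t ε h =>
    obtain ⟨m, s', t', rfl, rfl⟩ := s.exists_incl_eq_pair t
    rw [CTerm.subst_incl, CTerm.subst_incl]
    have h' : U.MonClosure (AlgSignature.toMonoidal s') (AlgSignature.toMonoidal t') ε :=
      .ax (.ax s' t' ε h)
    refine (h'.seq_left (tuple m fun i => AlgSignature.toMonoidal (σ i))).congr ?_ ?_ <;>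
    rw [Diagram.mk_toMonoidal_subst hE, Diagram.mk_seq]
  | bot s t => exact .bot _ _
  | mon _ hε ih => exact .mon (ih σ) hε
  | cont A _ ih => exact .join A fun ε hε => ih ε hε σ
  | refl h => exact .of_eq (Provable.mk_toMonoidal_subst U h σ) ⊤
  | triang _ _ ih ih' => exact .triang (ih σ) (ih' σ)
  | subst τ _ ih =>
    rw [CTerm.subst_subst, CTerm.subst_subst]
    exact ih _
  | nexp o _ ih => exact (MonClosure.tuple fun i => .mon (ih i σ) (iInf_le _ i)).seq_right (opT o)

theorem QProvable.monClosure {n : ℕ} {s t : CTerm U.sig (Fin n)} {ε : V}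
    (h : U.QProvable s.incl t.incl ε) :
    U.MonClosure (AlgSignature.toMonoidal s) (AlgSignature.toMonoidal t) ε := by
  have h := h.monClosure_subst (.retract s)
  rwa [CTerm.incl_subst_retract, CTerm.incl_subst_retract] at h

variable (U)

/-- One inequality evaluates a monoidal derivation at the generic stream of variables, which returns
the components; the other assembles the componentwise derivations into one between tuples. -/
theorem termDist_tupleTerm {n m : ℕ} (f g : Fin m → CTerm U.sig (Fin n)) :
    U.toMonoidal.termDist (U.tupleTerm f) (U.tupleTerm g) = U.tupleDist f g := by
  apply le_antisymm
  · refine U.le_tupleDist fun i => ?_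
    have h := U.qprovable_eval_of_closure
      (U.toMonoidal.closure_termDist (U.tupleTerm f) (U.tupleTerm g)) .var i.2
    rw [tupleTerm, tupleTerm, AlgSignature.eval_tuple, AlgSignature.eval_tuple,
      AlgSignature.eval_toMonoidal, AlgSignature.eval_toMonoidal, CTerm.subst_var,
      CTerm.subst_var] at h
    exact h
  · exact U.toMonoidal.le_termDist
      (MonClosure.tuple fun i => (U.qprovable_tupleDist f g i).monClosure)

end QAlgTheory

theorem mainTheorem6 {V : Type v} [AddCommMonoid V] [CompleteLattice V] [IsAddQuantale V]
    [IsIntegralQuantale V] (hV : IsIJD V) (U : QAlgTheory.{u} V) :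
    Nonempty (EnrichedIso V U.LT U.toMonoidal.Syn) :=
  ⟨{ functor := U.toSyn
     inverse := U.ofSyn
     functor_inverse := Functor.hext (fun _ => rfl) (by
       rintro n m ⟨f⟩
       exact heq_of_eq (congrArg (Quotient.mk (U.setoid n m)) (U.interpTerm_tupleTerm f)))
     inverse_functor := Functor.hext (fun _ => rfl) (by
       rintro n m ⟨s⟩
       exact heq_of_eq (Quotient.sound (U.tupleTerm_interpTerm s)))
     isometry := by
       rintro n m ⟨f⟩ ⟨g⟩
       exact U.termDist_tupleTerm f g }⟩
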